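/- **Setting.** Let $\mathfrak g=\mathbb R^n$ be the Lie algebra of an $n$-dimensional torus $G$, $S(\mathfrak g^*)$ the ring of polynomial functions on $\mathfrak g$ and $Q(\mathfrak g^*)$ its quotient field. Let $\Gamma$ be a finite $d$-valent graph with vertex set $V$; each edge occurs with both orientations, $i(e)$ and $t(e)$ are the initial and terminal vertices of an oriented edge $e$, and $\bar e$ is $e$ with reversed orientation. Let $G$ act on $\Gamma$ by a GKM action with axial function $e\mapsto\alpha_e\in\mathfrak g^*$. This means: $\alpha_{\bar e}=-\alpha_e$; for every $e$ there is a bijection $\theta$ from $\{f: i(f)=i(e),\,f\ne e\}$ to $\{f: i(f)=t(e),\,f\neq\bar e\}$ with $\alpha_{\theta(f)}-\alpha_f\in\mathbb R\,\alpha_e$ for all $f$; and the weights $\alpha_e$, $i(e)=p$, at each vertex $p$ are pairwise linearly independent. Let $\xi\in\mathfrak g$ satisfy $\alpha_e(\xi)\ne0$ for all $e$. An edge $e$ is ascending if $\alpha_e(\xi)>0$ and descending if $\alpha_e(\xi)<0$; a path is ascending (descending) if all its edges are, and paths of length $0$ are allowed. Assume that there is a Morse function, i.e. $\phi:V\to\mathbb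 R$ with $\phi(i(e))<\phi(t(e))$ for every ascending $e$. Let $E_p^-$ be the set of descending edges $e$ with $i(e)=p$, $\sigma_p=|E_p^-|$ the index of $p$, $\nu_p^+=\prod_{e\in E_p^-}\alpha_e$, and $\rho_e:S(\mathfrak g^*)\to S(\mathfrak g^*)$ the algebra homomorphism with $\rho_e(a)=a-\frac{a(\xi)}{\alpha_e(\xi)}\alpha_e$ for $a\in\mathfrak g^*$. Let $H(\Gamma,\alpha)$ be the ring of maps $h:V\to S(\mathfrak g^*)$ such that, for every $e$, $h_{i(e)}$ and $h_{t(e)}$ have the same restriction to $\ker\alpha_e\subset\mathfrak g$. Put $\int f=\sum_{t\in V}f_t\,\delta_t\in Q(\mathfrak g^*)$, where $\delta_t=\bigl(\prod_{i(e)=t}\alpha_e\bigr)^{-1}$. A *Thom class* of $p$ is an element $\tau$ of $H(\Gamma,\alpha)$ with all values homogeneous of degree $\sigma_p$, with $\tau(q)=0$ unless some ascending path joins $p$ to $q$, and with $\tau(p)=\nu_p^+$. Assume that every $p\in V$ has a Thom class. A Thom class $\tau$ of $p$ is *canonical* if it is given by interpolation, i.e. for every $q\ne p$ $$\tau(q)=\sum_{e\in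 E_q^-}\ \prod_{f\in E_q^-,\,f\ne e}\frac{\alpha_f}{\rho_e(\alpha_f)}\ \rho_e\bigl(\tau(t(e))\bigr).$$ For an ascending path $\gamma$ with edges $e_1,\dots,e_m$ ($m\ge1$) ending at $q$ put $$E(\gamma)=(-1)^m\,\nu_q^+\,\frac{\iota_{e_1}}{\hat\alpha_m}\prod_{k=2}^m\frac{\iota_{e_k}}{\hat\alpha_{k-1}-\hat\alpha_k},\qquad \hat\alpha_k=\frac{\alpha_{e_k}}{\alpha_{e_k}(\xi)},\qquad \iota_e=\frac1{\alpha_e(\xi)}\cdot\frac{\prod_{f\in E^-_{i(e)}}\rho_e(\alpha_f)}{\prod_{f\in E^-_{t(e)},\,f\ne\bar e}\rho_e(\alpha_f)},$$ and $E(\gamma)=\nu_q^+$ for the path of length $0$ at $q$. For a descending path, $E$ is defined in the same way with $-\xi$ in place of $\xi$; a (canonical) Thom class of $p$ for $-\xi$ is denoted $\tau_p^-$, one for $\xi$ is denoted $\tau_p^+$. **Theorem.** 1. Every vertex $p$ has exactly one canonical Thom class $\tau_p^+$ for $\xi$ and exactly one canonical Thom class $\tau_p^-$ for $-\xi$. With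 these classes, for all $p,q,r\in V$, $$c_{pqr}:=\int\tau_p^+\tau_q^+\tau_r^-=\sum\delta_t\,E(\gamma_1)E(\gamma_2)E(\gamma_3),\qquad(*)$$ where the sum is finite and runs over all $(t,\gamma_1,\gamma_2,\gamma_3)$ with $t\in V$, $\gamma_1$ an ascending path from $p$ to $t$, $\gamma_2$ an ascending path from $q$ to $t$, and $\gamma_3$ a descending path from $r$ to $t$. 2. Suppose that $\sigma$ is strictly increasing along ascending paths (of positive length). Let $\tau_p^+$ and $\tau_p^-$ ($p\in V$) be any Thom classes for $\xi$ and $-\xi$. Then $\int\tau_p^+\tau_q^-=\delta_{pq}$ (Kronecker delta) for all $p,q$. For all $p,q$ there are unique $c^r_{pq}\in S(\mathfrak g^*)$ with $\tau_p^+\tau_q^+=\sum_r c^r_{pq}\,\tau_r^+$, and $$c^r_{pq}=c_{pqr}=\int\tau_p^+\tau_q^+\tau_r^-,$$ so $c^r_{pq}$ is equal to the sum in $(*)$. -/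

import Mathlib

open scoped BigOperators Matrix

noncomputable section

/-- The symmetric algebra `S(𝔤*)` of the dual of `𝔤 = ℝⁿ`, the Lie algebra of an `n`-dimensional
torus: polynomial functions on `𝔤`, the variable `X i` being the `i`-th coordinate. -/
abbrev SymDual (n : ℕ) : Type := MvPolynomial (Fin n) ℝ

/-- The quotient field `Q(𝔤*)` of `S(𝔤*)`. -/
abbrev QuotField (n : ℕ) : Type := FractionRing (SymDual n)

/-- An element `a` of `𝔤*`, given by its coordinates (so that `a(x) = a ⬝ᵥ x` for `x ∈ 𝔤`),
regarded as an element of degree one of `S(𝔤*)`. -/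
def linForm {n : ℕ} (a : Fin n → ℝ) : SymDual n :=
  ∑ i, MvPolynomial.C (a i) * MvPolynomial.X i

/-- A GKM action of an `n`-dimensional torus on a finite `d`-valent graph. `V` is the set of
vertices, `E` the set of oriented edges (every edge occurs with both of its orientations, multiple
edges are allowed), and `wt` is the axial function `e ↦ α_e ∈ 𝔤*`. -/
structure GKMGraph (n d : ℕ) (V E : Type*) where
  /-- the initial vertex `i(e)` -/
  src : E → V
  /-- the terminal vertex `t(e)` -/
  tgt : E → V
  /-- the edge `e` with the reversed orientation -/
  bar : E → E
  bar_bar : ∀ e, bar (bar e) = e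
  src_bar : ∀ e, src (bar e) = tgt e
  valent : ∀ p, {e | src e = p}.ncard = d
  /-- the weight `α_e` -/
  wt : E → Fin n → ℝ
  wt_bar : ∀ e, wt (bar e) = - wt e
  /-- Along `e`, the other weights at the two ends agree modulo `α_e`, in a suitable order. -/
  wt_congr : ∀ e, ∃ θ : {f // src f = src e ∧ f ≠ e} ≃ {f // src f = tgt e ∧ f ≠ bar e},
    ∀ f, ∃ c : ℝ, wt (θ f).1 = wt f.1 + c • wt e
  /-- The GKM condition: the weights at a vertex are pairwise linearly independent. -/
  wt_indep : ∀ e f, src e = src f → e ≠ f → LinearIndependent ℝ ![wt e, wt f]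

namespace GKMGraph

variable {n d : ℕ} {V E : Type*}

/-- `ξ ∈ 𝒫`: no weight vanishes on `ξ`. -/
def IsPolarizing (Γ : GKMGraph n d V E) (ξ : Fin n → ℝ) : Prop :=
  ∀ e, Γ.wt e ⬝ᵥ ξ ≠ 0

/-- The oriented edge `e` is ascending with respect to `ξ`. (For `ξ ∈ 𝒫` an edge is descending
with respect to `ξ` if and only if it is ascending with respect to `-ξ`.) -/
def IsAscending (Γ : GKMGraph n d V E) (ξ : Fin n → ℝ) (e : E) : Prop :=
  0 < Γ.wt e ⬝ᵥ ξ

/-- `φ` is a `ξ`-compatible Morse function. -/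
def IsMorse (Γ : GKMGraph n d V E) (ξ : Fin n → ℝ) (φ : V → ℝ) : Prop :=
  ∀ e, Γ.IsAscending ξ e → φ (Γ.src e) < φ (Γ.tgt e)

/-- The list of oriented edges is an ascending path from `p` to `q` (the empty list is the path of
length zero from `p` to `p`). With `-ξ` in place of `ξ` these are the descending paths. -/
def IsAscPath (Γ : GKMGraph n d V E) (ξ : Fin n → ℝ) : V → List E → V → Prop
  | p, [], q => p = q
  | p, e :: l, q => Γ.src e = p ∧ Γ.IsAscending ξ e ∧ Γ.IsAscPath ξ (Γ.tgt e) l q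

/-- The equivariant cohomology ring `H(Γ, α)`: the maps `h : V → S(𝔤*)` such that, for every edge
`e`, the values at the two ends of `e` agree on the annihilator of `α_e` in `𝔤`. -/
def cohomology (Γ : GKMGraph n d V E) : Subalgebra (SymDual n) (V → SymDual n) where
  carrier := {h | ∀ e, ∀ x : Fin n → ℝ, Γ.wt e ⬝ᵥ x = 0 →
    MvPolynomial.eval x (h (Γ.src e)) = MvPolynomial.eval x (h (Γ.tgt e))}
  mul_mem' := by
    intro a b ha hb e x hx
    simp only [Pi.mul_apply, map_mul, ha e x hx, hb e x hx]
  add_mem' := by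
    intro a b ha hb e x hx
    simp only [Pi.add_apply, map_add, ha e x hx, hb e x hx]
  algebraMap_mem' := by
    intro r e x _
    rfl

/-- The projection `ρ_e : 𝔤* → 𝔤*_ξ`, `a ↦ a - (a(ξ) / α_e(ξ)) α_e`. -/
def rhoWt (Γ : GKMGraph n d V E) (ξ : Fin n → ℝ) (e : E) (a : Fin n → ℝ) : Fin n → ℝ :=
  a - ((a ⬝ᵥ ξ) / (Γ.wt e ⬝ᵥ ξ)) • Γ.wt e

/-- The extension of `ρ_e` to a homomorphism `S(𝔤*) → S(𝔤*_ξ) ⊆ S(𝔤*)`. -/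
def rho (Γ : GKMGraph n d V E) (ξ : Fin n → ℝ) (e : E) : SymDual n →ₐ[ℝ] SymDual n :=
  MvPolynomial.aeval fun i => linForm (Γ.rhoWt ξ e (Pi.single i 1))

section Finite

variable [Fintype V] [Fintype E]

open Classical in
/-- The set of descending edges with initial vertex `p`. -/
def descEdges (Γ : GKMGraph n d V E) (ξ : Fin n → ℝ) (p : V) : Finset E :=
  {e : E | Γ.src e = p ∧ Γ.wt e ⬝ᵥ ξ < 0}

/-- The index `σ_p`. -/
def index (Γ : GKMGraph n d V E) (ξ : Fin n → ℝ) (p : V) : ℕ :=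
  (Γ.descEdges ξ p).card

/-- The index function is strictly increasing along ascending paths. -/
def IndexIncreasing (Γ : GKMGraph n d V E) (ξ : Fin n → ℝ) : Prop :=
  ∀ p q γ, Γ.IsAscPath ξ p γ q → γ ≠ [] → Γ.index ξ p < Γ.index ξ q

/-- `ν_p⁺`, the product of the weights of the descending edges at `p`. -/
def nu (Γ : GKMGraph n d V E) (ξ : Fin n → ℝ) (p : V) : SymDual n :=
  ∏ e ∈ Γ.descEdges ξ p, linForm (Γ.wt e)

/-- `τ` is a Thom class of the vertex `p`: a class in `H(Γ, α)`, homogeneous of degree `σ_p`,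
supported on the vertices that an ascending path joins to `p`, with value `ν_p⁺` at `p`.
For `τ_p⁻` replace `ξ` by `-ξ`. -/
structure IsThomClass (Γ : GKMGraph n d V E) (ξ : Fin n → ℝ) (p : V) (τ : V → SymDual n) :
    Prop where
  mem : τ ∈ Γ.cohomology
  homogeneous : ∀ q, (τ q).IsHomogeneous (Γ.index ξ p)
  support : ∀ q, τ q ≠ 0 → ∃ γ, Γ.IsAscPath ξ p γ q
  value : τ p = Γ.nu ξ p

open Classical in
/-- `τ` is the Thom class of `p` produced by the inductive (interpolation) construction: at a
vertex `q ≠ p`, with descending edges `e_1, …, e_r`, the value of `τ` is the interpolation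
polynomial `∑ⱼ ∏_{k ≠ j} (α_{e_k} / ρ_{e_j}(α_{e_k})) · ρ_{e_j}(τ(t(e_j)))`
built from its values at the lower ends of these edges. -/
structure IsCanonicalThomClass (Γ : GKMGraph n d V E) (ξ : Fin n → ℝ) (p : V)
    (τ : V → SymDual n) : Prop extends Γ.IsThomClass ξ p τ where
  interpolation : ∀ q, q ≠ p → algebraMap (SymDual n) (QuotField n) (τ q) =
    ∑ e ∈ Γ.descEdges ξ q,
      (∏ f ∈ (Γ.descEdges ξ q).erase e,
        algebraMap (SymDual n) (QuotField n) (linForm (Γ.wt f)) /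
          algebraMap (SymDual n) (QuotField n) (linForm (Γ.rhoWt ξ e (Γ.wt f)))) *
      algebraMap (SymDual n) (QuotField n) (Γ.rho ξ e (τ (Γ.tgt e)))

open Classical in
/-- `δ_t`, the inverse of the product of all weights at `t`. -/
def delta (Γ : GKMGraph n d V E) (t : V) : QuotField n :=
  (∏ e : E with Γ.src e = t, algebraMap (SymDual n) (QuotField n) (linForm (Γ.wt e)))⁻¹

/-- The integration operation `∫ f = ∑_t f_t δ_t`. -/
def integral (Γ : GKMGraph n d V E) (f : V → SymDual n) : QuotField n :=
  ∑ t, algebraMap (SymDual n) (QuotField n) (f t) * Γ.delta t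

open Classical in
/-- The local intersection number of an ascending edge `e` from `p` to `q`: `ι_e = Θ_e / α_e(ξ)`,
where `Θ_e` is the product of the `ρ_e(α_f)` over the descending edges `f` at `p`, divided by the
product of the `ρ_e(α_f)` over the descending edges `f` at `q` other than the reverse of `e`. -/
def iota (Γ : GKMGraph n d V E) (ξ : Fin n → ℝ) (e : E) : QuotField n :=
  ((∏ f ∈ Γ.descEdges ξ (Γ.src e),
      algebraMap (SymDual n) (QuotField n) (linForm (Γ.rhoWt ξ e (Γ.wt f)))) /
    ∏ f ∈ (Γ.descEdges ξ (Γ.tgt e)).erase (Γ.bar e),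
      algebraMap (SymDual n) (QuotField n) (linForm (Γ.rhoWt ξ e (Γ.wt f)))) /
    algebraMap ℝ (QuotField n) (Γ.wt e ⬝ᵥ ξ)

/-- The normalized weight `α_e / α_e(ξ)`. -/
def hatWt (Γ : GKMGraph n d V E) (ξ : Fin n → ℝ) (e : E) : QuotField n :=
  algebraMap (SymDual n) (QuotField n) (linForm (Γ.wt e)) /
    algebraMap ℝ (QuotField n) (Γ.wt e ⬝ᵥ ξ)

/-- The weight `E(γ)` of an ascending path `γ` with terminal vertex `q` and edges `e_1, …, e_m`:
`(-1)^m ν_q⁺ (ι_{e_1} / α̂_m) ∏_{k=2}^m ι_{e_k} / (α̂_{k-1} - α̂_k)`,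
and `ν_q⁺` for the path of length zero. -/
def pathWeight (Γ : GKMGraph n d V E) (ξ : Fin n → ℝ) (q : V) : List E → QuotField n
  | [] => algebraMap (SymDual n) (QuotField n) (Γ.nu ξ q)
  | e :: l =>
    (-1) ^ (l.length + 1) * algebraMap (SymDual n) (QuotField n) (Γ.nu ξ q) *
      (Γ.iota ξ e / Γ.hatWt ξ ((e :: l).getLast (List.cons_ne_nil e l))) *
      (((e :: l).zip l).map fun x => Γ.iota ξ x.2 / (Γ.hatWt ξ x.1 - Γ.hatWt ξ x.2)).prod

/-- The configurations `(t, γ₁, γ₂, γ₃)`: ascending paths `γ₁` from `p` to `t` and `γ₂` from `q`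
to `t`, and a descending path `γ₃` from `r` to `t`. -/
def configurations (Γ : GKMGraph n d V E) (ξ : Fin n → ℝ) (p q r : V) :
    Set (V × List E × List E × List E) :=
  {c | Γ.IsAscPath ξ p c.2.1 c.1 ∧ Γ.IsAscPath ξ q c.2.2.1 c.1 ∧
    Γ.IsAscPath (-ξ) r c.2.2.2 c.1}

/-- The sum of `δ_t E(γ₁) E(γ₂) E(γ₃)` over all configurations; the weight of the descending path
`γ₃` is taken with respect to `-ξ`. -/
def configurationSum (Γ : GKMGraph n d V E) (ξ : Fin n → ℝ) (p q r : V) : QuotField n :=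
  ∑ᶠ c ∈ Γ.configurations ξ p q r,
    Γ.delta c.1 * Γ.pathWeight ξ c.1 c.2.1 * Γ.pathWeight ξ c.1 c.2.2.1 *
      Γ.pathWeight (-ξ) c.1 c.2.2.2

end Finite

end GKMGraph

end

/-! The triple formula follows from a path formula for the values of canonical classes. The map
`ρ_e` is pull-back along the projection of `𝔤` onto `ker α_e` in the direction `ξ`, so the
interpolation condition is Lagrange interpolation in one variable on the lines parallel to `ξ`. To
iterate it down the graph, one substitutes `x - yξ` for `x`: the parameter `y = α̂_e` gives `ρ_e`,
and `y = 0` gives the value itself. Induction on the height of `q` then gives `τ(q) = ∑ E(γ)`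
(`IsCanonicalThomClass.shift_eq`), and (*) is the product of three such sums.

Canonical classes exist because the interpolation error at `q` is a polynomial multiple of `ν_q⁺`
(`exists_sub_mul_nu_eq_interp`), which a multiple of a Thom class of `q` removes without disturbing
lower vertices. Thom classes for `-ξ` are not assumed; they come from Poincaré duality. Integrals of
classes are polynomials, since the poles at the two ends of an edge cancel, and the Gram matrix of
the Thom classes has determinant `±1`. The dual basis (`exists_dual`) consists of Thom classes for
`-ξ` (`exists_isThomClass_neg`).

If the index increases, degrees decide the rest: the interpolation error would have negative degree,
so every Thom class is canonical, and `∫ τ_p⁺ τ_q⁻` has negative degree when `p` lies strictly below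
`q`. Pairing with `τ_r⁻` then extracts the structure constants. -/

section Preliminaries

/-! ### Interpolation and denominators over a domain. -/

/-- Lagrange interpolation over a domain: up to a multiple of the product of the `-v i`, the
constant term of a polynomial is the value at `0` of the interpolation polynomial. -/
theorem exists_eval_zero_sub_eq_interpolation {R K ι : Type*} [CommRing R] [IsDomain R] [Field K]
    [Algebra R K] [FaithfulSMul R K] [DecidableEq ι] (H : Polynomial R) (s : Finset ι) (v : ι → R)
    (hv : Set.InjOn v s) :
    ∃ k : R, algebraMap R K (H.eval 0 - k * ∏ i ∈ s, (-v i)) =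
      ∑ i ∈ s, (∏ j ∈ s.erase i,
        (algebraMap R K (-v j) / (algebraMap R K (v i) - algebraMap R K (v j)))) *
          algebraMap R K (H.eval (v i)) := by
  have hN : (Lagrange.nodal s v).Monic := Lagrange.nodal_monic
  -- The nodal polynomial is monic, so division by it takes place over `R`; this is why `k` lies in
  -- `R` although the interpolation needs fractions. The remainder is the interpolation polynomial.
  have hdiv := Polynomial.modByMonic_add_div H (Lagrange.nodal s v)
  have hinj : Function.Injective (algebraMap R K) := FaithfulSMul.algebraMap_injective R K
  set r := H %ₘ Lagrange.nodal s v
  set k := H /ₘ Lagrange.nodal s v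
  have hev : ∀ x, H.eval x = r.eval x + (∏ i ∈ s, (x - v i)) * k.eval x := by
    intro x
    conv_lhs => rw [← hdiv]
    rw [Polynomial.eval_add, Polynomial.eval_mul, Lagrange.eval_nodal]
  have hdeg : (r.map (algebraMap R K)).degree < s.card := by
    rw [Polynomial.degree_map_eq_of_injective hinj, ← Lagrange.degree_nodal (v := v)]
    exact Polynomial.degree_modByMonic_lt _ hN
  have hr := Lagrange.eq_interpolate_of_eval_eq (v := fun i => algebraMap R K (v i))
    (fun i => algebraMap R K (H.eval (v i))) (fun i hi j hj h => hv hi hj (hinj h)) hdeg (by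
      intro i hi
      rw [Polynomial.eval_map_algebraMap, Polynomial.aeval_algebraMap_apply, hev,
        Finset.prod_eq_zero hi (sub_self _)]
      simp)
  refine ⟨k.eval 0, ?_⟩
  have h0 : H.eval 0 - k.eval 0 * ∏ i ∈ s, (-v i) = r.eval 0 := by
    rw [hev 0]; simp only [zero_sub]; ring
  have h1 : algebraMap R K (r.eval 0) = (r.map (algebraMap R K)).eval 0 := by
    rw [Polynomial.eval_map_algebraMap, ← map_zero (algebraMap R K),
      Polynomial.aeval_algebraMap_apply, Polynomial.coe_aeval_eq_eval]
  rw [h0, h1, hr, Lagrange.interpolate_apply, Polynomial.eval_finsetSum]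
  refine Finset.sum_congr rfl fun i _ => ?_
  rw [Polynomial.eval_mul, Polynomial.eval_C, mul_comm, Lagrange.basis, Polynomial.eval_prod]
  congr 1
  refine Finset.prod_congr rfl fun j _ => ?_
  simp only [Lagrange.basisDivisor, Polynomial.eval_mul, Polynomial.eval_C, Polynomial.eval_sub,
    Polynomial.eval_X, map_neg]
  rw [div_eq_mul_inv]; ring

theorem sum_div_mul_prod_eq {R L ι : Type*} [CommRing R] [Field L] [DecidableEq ι] (g : R →+* L)
    (s : Finset ι) (m a : ι → R) (ha : ∀ i ∈ s, g (a i) ≠ 0) :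
    (∑ i ∈ s, g (m i) / g (a i)) * ∏ i ∈ s, g (a i) =
      g (∑ i ∈ s, m i * ∏ j ∈ s.erase i, a j) := by
  rw [map_sum, Finset.sum_mul]
  refine Finset.sum_congr rfl fun i hi => ?_
  rw [← Finset.mul_prod_erase s _ hi, map_mul, map_prod]
  field_simp [ha i hi]

/-- An identity of fractions is preserved by homomorphisms to a field which do not kill the
denominators. -/
theorem map_eq_sum_div_of_algebraMap_eq {R K L ι : Type*} [CommRing R] [Field K] [Algebra R K]
    [FaithfulSMul R K] [Field L] (ψ : R →+* L) (s : Finset ι) (z : R) (m a : ι → R)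
    (ha : ∀ i ∈ s, ψ (a i) ≠ 0)
    (h : algebraMap R K z = ∑ i ∈ s, algebraMap R K (m i) / algebraMap R K (a i)) :
    ψ z = ∑ i ∈ s, ψ (m i) / ψ (a i) := by
  classical
  have hinj : Function.Injective (algebraMap R K) := FaithfulSMul.algebraMap_injective R K
  have ha' : ∀ i ∈ s, algebraMap R K (a i) ≠ 0 := by
    intro i hi h0
    rw [map_eq_zero_iff _ hinj] at h0
    exact ha i hi (by rw [h0, map_zero])
  have h1 : z * ∏ i ∈ s, a i = ∑ i ∈ s, m i * ∏ j ∈ s.erase i, a j := by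
    apply hinj
    rw [← sum_div_mul_prod_eq _ _ _ _ ha', map_mul, h, map_prod]
  have h2 := sum_div_mul_prod_eq ψ s m a ha
  rw [← h1, map_mul, map_prod] at h2
  exact (mul_right_cancel₀ (Finset.prod_ne_zero_iff.2 ha) h2).symm

/-- A fraction that becomes integral after multiplication by a product of primes, none of which
is needed in the denominator, is integral. -/
theorem exists_algebraMap_eq_of_forall_prime {R K : Type*} [CommRing R] [IsDomain R] [Field K]
    [Algebra R K] [FaithfulSMul R K] {ι : Type*} (s : Finset ι) (π : ι → R)
    (hπ : ∀ i ∈ s, Prime (π i)) (x : K)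
    (hx : ∃ y, algebraMap R K y = algebraMap R K (∏ i ∈ s, π i) * x)
    (hloc : ∀ i ∈ s, ∃ t, ¬ π i ∣ t ∧ ∃ y, algebraMap R K y = algebraMap R K t * x) :
    ∃ y, algebraMap R K y = x := by
  classical
  have hinj : Function.Injective (algebraMap R K) := FaithfulSMul.algebraMap_injective R K
  induction s using Finset.induction_on with
  | empty => simpa using hx
  | insert i s hi ih =>
    refine ih (fun j hj => hπ j (Finset.mem_insert_of_mem hj)) ?_
      fun j hj => hloc j (Finset.mem_insert_of_mem hj)
    obtain ⟨y, hy⟩ := hx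
    obtain ⟨t, ht, w, hw⟩ := hloc i (Finset.mem_insert_self i s)
    have hp := hπ i (Finset.mem_insert_self i s)
    rw [Finset.prod_insert hi, map_mul] at hy
    have h1 : t * y = π i * ((∏ j ∈ s, π j) * w) := by
      apply hinj
      simp only [map_mul, hy, hw]; ring
    obtain ⟨y', rfl⟩ := (hp.dvd_or_dvd ⟨_, h1⟩).resolve_left ht
    refine ⟨y', ?_⟩
    have h0 : algebraMap R K (π i) ≠ 0 := fun h => hp.ne_zero (hinj (by rw [h, map_zero]))
    apply mul_left_cancel₀ h0
    rw [← map_mul, hy, mul_assoc]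

end Preliminaries

/-! ### Translation along `ξ`, and dilation as a measure of degree. -/

section LinForm

open MvPolynomial

variable {n : ℕ}

theorem linForm_add (a b : Fin n → ℝ) : linForm (a + b) = linForm a + linForm b := by
  simp [linForm, add_mul, Finset.sum_add_distrib]

theorem linForm_smul (c : ℝ) (a : Fin n → ℝ) : linForm (c • a) = C c * linForm a := by
  simp [linForm, Finset.mul_sum, mul_assoc]

theorem linForm_neg (a : Fin n → ℝ) : linForm (-a) = -linForm a := by
  simp [linForm]

theorem linForm_sub (a b : Fin n → ℝ) : linForm (a - b) = linForm a - linForm b := by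
  rw [sub_eq_add_neg, linForm_add, linForm_neg, sub_eq_add_neg]

theorem eval_linForm (a x : Fin n → ℝ) : eval x (linForm a) = a ⬝ᵥ x := by
  simp [linForm, dotProduct]

theorem linForm_ne_zero {a : Fin n → ℝ} (ha : a ≠ 0) : linForm a ≠ 0 := by
  intro h
  have := eval_linForm a a
  rw [h, map_zero] at this
  exact ha (dotProduct_self_eq_zero.1 this.symm)

theorem linForm_single (i : Fin n) : linForm (Pi.single i 1) = X i := by
  rw [linForm, Finset.sum_eq_single i]
  · simp
  · intro j _ hj; simp [Pi.single_eq_of_ne hj]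
  · simp

/-- The substitution `h(x) ↦ h(x - y ξ)`. -/
noncomputable def shift (ξ : Fin n → ℝ) {A : Type*} [CommRing A] [Algebra (SymDual n) A]
    [Algebra ℝ A] (y : A) : SymDual n →ₐ[ℝ] A :=
  aeval fun i => algebraMap (SymDual n) A (X i) - algebraMap ℝ A (ξ i) * y

section Shift

variable (ξ : Fin n → ℝ) {A B : Type*} [CommRing A] [Algebra (SymDual n) A] [Algebra ℝ A]
  [CommRing B] [Algebra (SymDual n) B] [Algebra ℝ B]

theorem shift_X (y : A) (i : Fin n) :
    shift ξ y (X i) = algebraMap (SymDual n) A (X i) - algebraMap ℝ A (ξ i) * y := by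
  simp [shift]

theorem shift_linForm [IsScalarTower ℝ (SymDual n) A] (y : A) (a : Fin n → ℝ) :
    shift ξ y (linForm a) = algebraMap (SymDual n) A (linForm a) - algebraMap ℝ A (a ⬝ᵥ ξ) * y := by
  have hC : ∀ r : ℝ, algebraMap (SymDual n) A (C r) = algebraMap ℝ A r := fun r =>
    (IsScalarTower.algebraMap_apply ℝ (SymDual n) A r).symm
  simp only [linForm, map_sum, map_mul, shift_X, hC, dotProduct, Finset.sum_mul,
    ← Finset.sum_sub_distrib, algHom_C]
  exact Finset.sum_congr rfl fun i _ => by ring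

theorem shift_zero [IsScalarTower ℝ (SymDual n) A] (h : SymDual n) :
    shift ξ (0 : A) h = algebraMap (SymDual n) A h := by
  have : shift ξ (0 : A) = IsScalarTower.toAlgHom ℝ (SymDual n) A := by
    apply algHom_ext
    intro i
    simp [shift_X]
  rw [this]; rfl

theorem map_shift (g : A →ₐ[ℝ] B)
    (hg : ∀ p, g (algebraMap (SymDual n) A p) = algebraMap (SymDual n) B p) (y : A)
    (h : SymDual n) : g (shift ξ y h) = shift ξ (g y) h := by
  have : g.comp (shift ξ y) = shift ξ (g y) := by
    apply algHom_ext
    intro i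
    rw [AlgHom.comp_apply, shift_X, shift_X]
    simp [hg]
  rw [← this]; rfl

end Shift

/-- The substitution `h(x) ↦ h(2x)`. -/
noncomputable def dilate (n : ℕ) : SymDual n →ₐ[ℝ] SymDual n := aeval fun i => C 2 * X i

theorem coeff_dilate (h : SymDual n) (m : Fin n →₀ ℕ) :
    coeff m (dilate n h) = 2 ^ m.degree * coeff m h := by
  classical
  induction h using MvPolynomial.induction_on' with
  | monomial u a =>
    have : dilate n (monomial u a) = monomial u (2 ^ u.degree * a) := by
      rw [dilate, aeval_monomial, monomial_eq (a := 2 ^ u.degree * a)]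
      simp only [Finsupp.prod, mul_pow, Finset.prod_mul_distrib, algebraMap_eq, C_mul, C_pow,
        Finset.prod_pow_eq_pow_sum, Finsupp.degree]
      ring_nf
      rfl
    rw [this, coeff_monomial, coeff_monomial]
    split_ifs with huv
    · rw [huv]
    · simp
  | add p q hp hq => rw [map_add, coeff_add, hp, hq, coeff_add]; ring

theorem dilate_injective : Function.Injective (dilate n) := by
  rw [injective_iff_map_eq_zero]
  intro h hh
  ext m
  have := coeff_dilate h m
  rw [hh, coeff_zero] at this
  simpa using this.symm

/-- Degrees are tracked through this eigenvalue equation because dilation extends to fractions; with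
powers of 2 on both sides it also expresses negative degrees. -/
theorem dilate_eq_of_isHomogeneous {h : SymDual n} {m : ℕ} (hh : h.IsHomogeneous m) :
    dilate n h = C (2 ^ m) * h := by
  ext u
  rw [coeff_dilate, coeff_C_mul]
  by_cases hu : u.degree = m
  · rw [hu]
  · rw [hh.coeff_eq_zero hu]; simp

theorem pow_two_real_injective {a b : ℕ} (h : (2 : ℝ) ^ a = 2 ^ b) : a = b :=
  pow_right_injective₀ (by norm_num : (0 : ℝ) < 2) (by norm_num) h

/-- If `h(2x) 2^k = 2^m h(x)`, then all nonzero terms of `h` have degree `m - k`. -/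
theorem degree_of_dilate_eq {h : SymDual n} {k m : ℕ}
    (hh : C (2 ^ k) * dilate n h = C (2 ^ m) * h) {u : Fin n →₀ ℕ} (hu : coeff u h ≠ 0) :
    u.degree + k = m := by
  have := congrArg (coeff u) hh
  rw [coeff_C_mul, coeff_C_mul, coeff_dilate, ← mul_assoc] at this
  have h2 := mul_right_cancel₀ hu this
  rw [← pow_add] at h2
  rw [add_comm]
  exact pow_two_real_injective h2

theorem isHomogeneous_of_dilate_eq {h : SymDual n} {k l m : ℕ}
    (hh : C (2 ^ k) * dilate n h = C (2 ^ m) * h) (hl : l + k = m) : h.IsHomogeneous l := by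
  intro u hu
  have h1 : u.degree = l := by
    have := degree_of_dilate_eq hh hu
    omega
  rw [← h1, Finsupp.degree_eq_weight_one]
  rfl

theorem eq_zero_of_dilate_eq {h : SymDual n} {k m : ℕ}
    (hh : C (2 ^ k) * dilate n h = C (2 ^ m) * h) (hkm : m < k) : h = 0 := by
  ext u
  by_contra hu
  have := degree_of_dilate_eq hh hu
  omega

theorem isHomogeneous_linForm (a : Fin n → ℝ) : (linForm a).IsHomogeneous 1 :=
  IsHomogeneous.sum _ _ _ fun i _ => isHomogeneous_C_mul_X _ i

theorem dilate_linForm (a : Fin n → ℝ) : dilate n (linForm a) = C 2 * linForm a := by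
  simpa using dilate_eq_of_isHomogeneous (isHomogeneous_linForm a)

/-- The extension of `dilate` to the quotient field. -/
noncomputable def dilateQuot (n : ℕ) : QuotField n →+* QuotField n :=
  IsFractionRing.lift (A := SymDual n)
    (g := (algebraMap (SymDual n) (QuotField n)).comp (dilate n : SymDual n →+* SymDual n))
    ((FaithfulSMul.algebraMap_injective _ _).comp dilate_injective)

theorem dilateQuot_algebraMap (h : SymDual n) :
    dilateQuot n (algebraMap (SymDual n) (QuotField n) h) =
      algebraMap (SymDual n) (QuotField n) (dilate n h) := by
  exact IsFractionRing.lift_algebraMap (A := SymDual n) (K := QuotField n) _ h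

end LinForm

/-! ### The projections `ρ_e`, weights and indices. -/

namespace GKMGraph

open MvPolynomial

variable {n d : ℕ} {V E : Type*} {Γ : GKMGraph n d V E} {ξ : Fin n → ℝ}

theorem tgt_bar (Γ : GKMGraph n d V E) (e : E) : Γ.tgt (Γ.bar e) = Γ.src e := by
  rw [← Γ.src_bar, Γ.bar_bar]

theorem bar_injective (Γ : GKMGraph n d V E) : Function.Injective Γ.bar :=
  Function.LeftInverse.injective Γ.bar_bar

theorem IsPolarizing.neg (hξ : Γ.IsPolarizing ξ) : Γ.IsPolarizing (-ξ) := fun e => by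
  simpa using hξ e

theorem IsPolarizing.wt_ne_zero (hξ : Γ.IsPolarizing ξ) (e : E) : Γ.wt e ≠ 0 := fun h =>
  hξ e (by simp [h])

theorem wt_bar_dotProduct (Γ : GKMGraph n d V E) (e : E) (x : Fin n → ℝ) :
    Γ.wt (Γ.bar e) ⬝ᵥ x = -(Γ.wt e ⬝ᵥ x) := by
  rw [Γ.wt_bar, neg_dotProduct]

theorem rhoWt_bar (Γ : GKMGraph n d V E) (ξ : Fin n → ℝ) (e : E) (a : Fin n → ℝ) :
    Γ.rhoWt ξ (Γ.bar e) a = Γ.rhoWt ξ e a := by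
  rw [rhoWt, rhoWt, wt_bar_dotProduct, Γ.wt_bar, div_neg, neg_smul_neg]

theorem rhoWt_neg (Γ : GKMGraph n d V E) (ξ : Fin n → ℝ) (e : E) (a : Fin n → ℝ) :
    Γ.rhoWt ξ e (-a) = -Γ.rhoWt ξ e a := by
  rw [rhoWt, rhoWt, neg_dotProduct, neg_div, neg_smul, neg_sub, sub_neg_eq_add, neg_add_eq_sub]

theorem rhoWt_self (hξ : Γ.IsPolarizing ξ) (e : E) : Γ.rhoWt ξ e (Γ.wt e) = 0 := by
  rw [rhoWt, div_self (hξ e), one_smul, sub_self]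

theorem rhoWt_dotProduct (hξ : Γ.IsPolarizing ξ) (e : E) (a : Fin n → ℝ) :
    Γ.rhoWt ξ e a ⬝ᵥ ξ = 0 := by
  rw [rhoWt, sub_dotProduct, smul_dotProduct, smul_eq_mul, div_mul_cancel₀ _ (hξ e), sub_self]

theorem rhoWt_add_smul (hξ : Γ.IsPolarizing ξ) (e : E) (a : Fin n → ℝ) (c : ℝ) :
    Γ.rhoWt ξ e (a + c • Γ.wt e) = Γ.rhoWt ξ e a := by
  have := hξ e
  rw [rhoWt, rhoWt, add_dotProduct, smul_dotProduct, smul_eq_mul, add_div,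
    mul_div_cancel_right₀ _ this, add_smul]
  abel

theorem rhoWt_ne_zero (ξ : Fin n → ℝ) {e f : E} (h : Γ.src e = Γ.src f) (hne : f ≠ e) :
    Γ.rhoWt ξ e (Γ.wt f) ≠ 0 := by
  intro h0
  have := (LinearIndependent.pair_iff.1 (Γ.wt_indep e f h hne.symm))
    (-((Γ.wt f ⬝ᵥ ξ) / (Γ.wt e ⬝ᵥ ξ))) 1 (by
      rw [one_smul, neg_smul, neg_add_eq_sub]; exact h0)
  exact one_ne_zero this.2

/-- The point `x - α̂_e(x) ξ` is where the line through `x` in direction `ξ` meets `ker α_e`. -/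
theorem rho_eq_shift (Γ : GKMGraph n d V E) (ξ : Fin n → ℝ) (e : E) :
    Γ.rho ξ e = shift ξ (C (Γ.wt e ⬝ᵥ ξ)⁻¹ * linForm (Γ.wt e) : SymDual n) := by
  apply algHom_ext
  intro i
  rw [rho, aeval_X, shift_X, rhoWt, linForm_sub, linForm_single, linForm_smul, div_eq_mul_inv,
    C_mul, single_dotProduct, one_mul, mul_assoc]
  rfl

theorem rho_linForm (Γ : GKMGraph n d V E) (ξ : Fin n → ℝ) (e : E) (a : Fin n → ℝ) :
    Γ.rho ξ e (linForm a) = linForm (Γ.rhoWt ξ e a) := by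
  rw [rho_eq_shift, shift_linForm, rhoWt, linForm_sub, linForm_smul, div_eq_mul_inv, C_mul,
    mul_assoc]
  rfl

theorem rho_X (Γ : GKMGraph n d V E) (ξ : Fin n → ℝ) (e : E) (i : Fin n) :
    Γ.rho ξ e (X i) = linForm (Γ.rhoWt ξ e (Pi.single i 1)) := by
  rw [rho, aeval_X]

theorem rho_bar (Γ : GKMGraph n d V E) (ξ : Fin n → ℝ) (e : E) :
    Γ.rho ξ (Γ.bar e) = Γ.rho ξ e := by
  apply algHom_ext
  intro i
  rw [rho_X, rho_X, rhoWt_bar]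

theorem algebraMap_rho (Γ : GKMGraph n d V E) (ξ : Fin n → ℝ) (e : E) (h : SymDual n) :
    algebraMap (SymDual n) (QuotField n) (Γ.rho ξ e h) = shift ξ (Γ.hatWt ξ e) h := by
  have hC : ∀ r : ℝ, algebraMap (SymDual n) (QuotField n) (C r) = algebraMap ℝ (QuotField n) r :=
    fun r => (IsScalarTower.algebraMap_apply ℝ (SymDual n) (QuotField n) r).symm
  rw [rho_eq_shift]
  have := map_shift ξ (IsScalarTower.toAlgHom ℝ (SymDual n) (QuotField n)) (fun _ => rfl)
    (C (Γ.wt e ⬝ᵥ ξ)⁻¹ * linForm (Γ.wt e)) h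
  rw [IsScalarTower.coe_toAlgHom'] at this
  rw [this, map_mul, hC, map_inv₀, hatWt, div_eq_inv_mul]

/-- Polynomials in the image of `ρ_e` are constant along the direction `ξ`. Hence the denominators
of the interpolation formula survive every translation. -/
theorem shift_rho (hξ : Γ.IsPolarizing ξ) (e : E) (y : QuotField n) (h : SymDual n) :
    shift ξ y (Γ.rho ξ e h) = algebraMap (SymDual n) (QuotField n) (Γ.rho ξ e h) := by
  have : (shift ξ y).comp (Γ.rho ξ e) =
      (IsScalarTower.toAlgHom ℝ (SymDual n) (QuotField n)).comp (Γ.rho ξ e) := by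
    apply algHom_ext
    intro i
    rw [AlgHom.comp_apply, AlgHom.comp_apply, rho_X, shift_linForm, rhoWt_dotProduct hξ]
    simp
  exact congrArg (fun g => g h) this

theorem rho_wt_self (hξ : Γ.IsPolarizing ξ) (e : E) : Γ.rho ξ e (linForm (Γ.wt e)) = 0 := by
  rw [rho_linForm, rhoWt_self hξ]; simp [linForm]

theorem linForm_dvd_sub_rho (Γ : GKMGraph n d V E) (ξ : Fin n → ℝ) (e : E) (h : SymDual n) :
    linForm (Γ.wt e) ∣ h - Γ.rho ξ e h := by
  induction h using MvPolynomial.induction_on with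
  | C a => simp [rho]
  | add p q hp hq => rw [map_add, add_sub_add_comm]; exact dvd_add hp hq
  | mul_X p i hp =>
    have h1 : linForm (Γ.wt e) ∣ X i - Γ.rho ξ e (X i) := by
      rw [rho_X, rhoWt, linForm_sub, linForm_single, linForm_smul, sub_sub_cancel]
      exact dvd_mul_left _ _
    have : p * X i - Γ.rho ξ e (p * X i) =
        (p - Γ.rho ξ e p) * X i + Γ.rho ξ e p * (X i - Γ.rho ξ e (X i)) := by
      rw [map_mul]; ring
    rw [this]
    exact dvd_add (hp.mul_right _) (h1.mul_left _)

theorem rho_eq_zero_iff (hξ : Γ.IsPolarizing ξ) {e : E} {h : SymDual n} :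
    Γ.rho ξ e h = 0 ↔ linForm (Γ.wt e) ∣ h := by
  constructor
  · intro h0
    have := Γ.linForm_dvd_sub_rho ξ e h
    rwa [h0, sub_zero] at this
  · rintro ⟨k, rfl⟩
    rw [map_mul, rho_wt_self hξ, zero_mul]

/-- The ideal generated by `α_e` is the kernel of `ρ_e`, a homomorphism to a domain. -/
theorem prime_linForm_wt (hξ : Γ.IsPolarizing ξ) (e : E) : Prime (linForm (Γ.wt e)) := by
  refine ⟨linForm_ne_zero (hξ.wt_ne_zero e), fun hu => ?_, fun a b hab => ?_⟩
  · have := hu.map (Γ.rho ξ e)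
    rw [rho_wt_self hξ] at this
    exact not_isUnit_zero this
  · rw [← rho_eq_zero_iff hξ, map_mul] at hab
    simpa [rho_eq_zero_iff hξ] using hab

theorem eval_rho (Γ : GKMGraph n d V E) (ξ : Fin n → ℝ) (e : E) (h : SymDual n) (x : Fin n → ℝ) :
    eval x (Γ.rho ξ e h) = eval (x - ((Γ.wt e ⬝ᵥ x) / (Γ.wt e ⬝ᵥ ξ)) • ξ) h := by
  induction h using MvPolynomial.induction_on with
  | C a => simp [rho]
  | add p q hp hq => rw [map_add, map_add, hp, hq, map_add]
  | mul_X p i hp =>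
    rw [map_mul, map_mul, hp, map_mul, rho_X, eval_linForm, rhoWt, sub_dotProduct,
      smul_dotProduct, single_dotProduct, single_dotProduct, eval_X]
    simp only [one_mul, smul_eq_mul, Pi.sub_apply, Pi.smul_apply]
    ring

/-- Turns the pointwise condition on `ker α_e` into an identity of polynomials, since the projection
along `ξ` maps `𝔤` onto `ker α_e` and fixes it. -/
theorem mem_cohomology_iff (hξ : Γ.IsPolarizing ξ) {h : V → SymDual n} :
    h ∈ Γ.cohomology ↔ ∀ e, Γ.rho ξ e (h (Γ.src e)) = Γ.rho ξ e (h (Γ.tgt e)) := by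
  constructor
  · intro hh e
    apply MvPolynomial.funext
    intro x
    rw [eval_rho, eval_rho]
    apply hh e
    rw [dotProduct_sub, dotProduct_smul, smul_eq_mul, div_mul_cancel₀ _ (hξ e), sub_self]
  · intro hh e x hx
    have := congrArg (eval x) (hh e)
    rw [eval_rho, eval_rho, hx] at this
    simpa using this

theorem dilate_rho (Γ : GKMGraph n d V E) (ξ : Fin n → ℝ) (e : E) (h : SymDual n) :
    dilate n (Γ.rho ξ e h) = Γ.rho ξ e (dilate n h) := by
  have : (dilate n).comp (Γ.rho ξ e) = (Γ.rho ξ e).comp (dilate n) := by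
    apply algHom_ext
    intro i
    rw [AlgHom.comp_apply, AlgHom.comp_apply, rho_X, dilate_linForm, dilate, aeval_X, map_mul,
      rho_X, algHom_C]
    rfl
  exact congrArg (fun g => g h) this

section Finite

variable [Fintype E]

theorem mem_descEdges {p : V} {e : E} :
    e ∈ Γ.descEdges ξ p ↔ Γ.src e = p ∧ Γ.wt e ⬝ᵥ ξ < 0 := by
  simp [descEdges]

theorem rho_nu_ne_zero_of_notMem {e : E} {p : V} (he : Γ.src e = p)
    (hd : e ∉ Γ.descEdges ξ p) : Γ.rho ξ e (Γ.nu ξ p) ≠ 0 := by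
  rw [nu, map_prod, Finset.prod_ne_zero_iff]
  intro f hf
  rw [rho_linForm]
  refine linForm_ne_zero (rhoWt_ne_zero ξ ?_ ?_)
  · rw [he, (mem_descEdges.1 hf).1]
  · rintro rfl; exact hd hf

theorem nu_ne_zero (hξ : Γ.IsPolarizing ξ) (p : V) : Γ.nu ξ p ≠ 0 :=
  Finset.prod_ne_zero_iff.2 fun e _ => linForm_ne_zero (hξ.wt_ne_zero e)

theorem isHomogeneous_nu (Γ : GKMGraph n d V E) (ξ : Fin n → ℝ) (p : V) :
    (Γ.nu ξ p).IsHomogeneous (Γ.index ξ p) := by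
  have := IsHomogeneous.prod (Γ.descEdges ξ p) (fun e => linForm (Γ.wt e)) (fun _ => 1)
    fun e _ => isHomogeneous_linForm _
  simpa [nu, index] using this

open Classical in
theorem filter_src_eq_union (hξ : Γ.IsPolarizing ξ) (p : V) :
    Finset.univ.filter (fun e => Γ.src e = p) = Γ.descEdges ξ p ∪ Γ.descEdges (-ξ) p := by
  ext e
  simp only [Finset.mem_filter, Finset.mem_univ, true_and, Finset.mem_union, mem_descEdges,
    dotProduct_neg, neg_lt_zero]
  constructor
  · intro h
    rcases lt_or_gt_of_ne (hξ e) with h' | h'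
    · exact Or.inl ⟨h, h'⟩
    · exact Or.inr ⟨h, h'⟩
  · rintro (h | h) <;> exact h.1

theorem disjoint_descEdges (Γ : GKMGraph n d V E) (ξ : Fin n → ℝ) (p : V) :
    Disjoint (Γ.descEdges ξ p) (Γ.descEdges (-ξ) p) := by
  rw [Finset.disjoint_left]
  intro e h1 h2
  have h1 := (mem_descEdges.1 h1).2
  have h2 := (mem_descEdges.1 h2).2
  rw [dotProduct_neg] at h2
  linarith

theorem index_add_index_neg (hξ : Γ.IsPolarizing ξ) (p : V) :
    Γ.index ξ p + Γ.index (-ξ) p = d := by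
  classical
  rw [index, index, ← Finset.card_union_of_disjoint (Γ.disjoint_descEdges ξ p),
    ← filter_src_eq_union hξ]
  refine Eq.trans ?_ (Γ.valent p)
  rw [Set.ncard_eq_toFinset_card']
  congr 1
  ext e; simp

theorem delta_eq (hξ : Γ.IsPolarizing ξ) (p : V) :
    Γ.delta p = (algebraMap (SymDual n) (QuotField n) (Γ.nu ξ p * Γ.nu (-ξ) p))⁻¹ := by
  classical
  have h : Finset.univ.filter (fun e => Γ.src e = p) = Γ.descEdges ξ p ∪ Γ.descEdges (-ξ) p :=
    filter_src_eq_union hξ p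
  rw [delta, ← map_prod, nu, nu, ← Finset.prod_union (Γ.disjoint_descEdges ξ p), ← h]

theorem delta_ne_zero (hξ : Γ.IsPolarizing ξ) (p : V) : Γ.delta p ≠ 0 := by
  rw [delta_eq hξ, map_mul]
  refine inv_ne_zero (mul_ne_zero ?_ ?_)
  · simpa using nu_ne_zero hξ p
  · simpa using nu_ne_zero hξ.neg p

end Finite

end GKMGraph

/-! ### Integrals of cohomology classes are polynomials. -/

namespace GKMGraph

open MvPolynomial

variable {n d : ℕ} {V E : Type*} {Γ : GKMGraph n d V E} {ξ : Fin n → ℝ}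

/-- The fraction `x` has no pole along the hyperplane `α_e = 0`. -/
def IsRegularAlong (Γ : GKMGraph n d V E) (ξ : Fin n → ℝ) (e : E) (x : QuotField n) : Prop :=
  ∃ s, Γ.rho ξ e s ≠ 0 ∧ ∃ y, algebraMap (SymDual n) (QuotField n) y =
    algebraMap (SymDual n) (QuotField n) s * x

theorem isRegularAlong_algebraMap (Γ : GKMGraph n d V E) (ξ : Fin n → ℝ) (e : E) (y : SymDual n) :
    Γ.IsRegularAlong ξ e (algebraMap (SymDual n) (QuotField n) y) :=
  ⟨1, by simp, y, by simp⟩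

theorem IsRegularAlong.add {e : E} {x y : QuotField n} (hx : Γ.IsRegularAlong ξ e x)
    (hy : Γ.IsRegularAlong ξ e y) : Γ.IsRegularAlong ξ e (x + y) := by
  obtain ⟨s, hs, u, hu⟩ := hx
  obtain ⟨t, ht, v, hv⟩ := hy
  refine ⟨s * t, by rw [map_mul]; exact mul_ne_zero hs ht, t * u + s * v, ?_⟩
  simp only [map_add, map_mul, hu, hv]
  ring

theorem IsRegularAlong.mul {e : E} {x y : QuotField n} (hx : Γ.IsRegularAlong ξ e x)
    (hy : Γ.IsRegularAlong ξ e y) : Γ.IsRegularAlong ξ e (x * y) := by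
  obtain ⟨s, hs, u, hu⟩ := hx
  obtain ⟨t, ht, v, hv⟩ := hy
  refine ⟨s * t, by rw [map_mul]; exact mul_ne_zero hs ht, u * v, ?_⟩
  simp only [map_mul, hu, hv]
  ring

theorem isRegularAlong_sum {ι : Type*} {e : E} (s : Finset ι) (x : ι → QuotField n)
    (hx : ∀ i ∈ s, Γ.IsRegularAlong ξ e (x i)) : Γ.IsRegularAlong ξ e (∑ i ∈ s, x i) := by
  classical
  induction s using Finset.induction_on with
  | empty => simpa using Γ.isRegularAlong_algebraMap ξ e 0
  | insert i s hi ih =>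
    rw [Finset.sum_insert hi]
    exact (hx i (Finset.mem_insert_self i s)).add
      (ih fun j hj => hx j (Finset.mem_insert_of_mem hj))

theorem isRegularAlong_inv {e : E} {s : SymDual n} (hs : Γ.rho ξ e s ≠ 0) :
    Γ.IsRegularAlong ξ e (algebraMap (SymDual n) (QuotField n) s)⁻¹ := by
  refine ⟨s, hs, 1, ?_⟩
  have : algebraMap (SymDual n) (QuotField n) s ≠ 0 := by
    simp only [ne_eq, FaithfulSMul.algebraMap_eq_zero_iff]
    rintro rfl
    exact hs (map_zero _)
  rw [mul_inv_cancel₀ this, map_one]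

/-- The hypothesis says that the weights of `e` and `g` are proportional, so both edges have the
same hyperplane and the same projection. -/
theorem rho_eq_of_rhoWt_eq_zero (hξ : Γ.IsPolarizing ξ) {e g : E}
    (h : Γ.rhoWt ξ e (Γ.wt g) = 0) : Γ.rho ξ g = Γ.rho ξ e := by
  apply algHom_ext
  intro i
  rw [rho_X, rho_X]
  congr 1
  rw [rhoWt, sub_eq_zero] at h
  have he := hξ e
  have hg := hξ g
  rw [rhoWt, rhoWt]
  congr 1
  nth_rw 2 [h]
  rw [smul_smul]
  congr 1
  field_simp

section Finite

variable [Fintype E]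

open Classical in
/-- The product of the weights of the edges other than `e` at the initial vertex of `e`. -/
noncomputable def otherWeights (Γ : GKMGraph n d V E) (e : E) : SymDual n :=
  ∏ f : E with Γ.src f = Γ.src e ∧ f ≠ e, linForm (Γ.wt f)

theorem delta_src (Γ : GKMGraph n d V E) (e : E) : Γ.delta (Γ.src e) =
    (algebraMap (SymDual n) (QuotField n) (linForm (Γ.wt e) * Γ.otherWeights e))⁻¹ := by
  classical
  rw [delta, ← map_prod, otherWeights]
  congr 2
  rw [← Finset.mul_prod_erase (Finset.univ.filter fun f => Γ.src f = Γ.src e)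
    (fun f => linForm (Γ.wt f)) (a := e) (by simp)]
  congr 1
  refine Finset.prod_congr ?_ fun _ _ => rfl
  ext f
  simp [and_comm]

theorem rho_otherWeights_ne_zero (Γ : GKMGraph n d V E) (ξ : Fin n → ℝ) (e : E) :
    Γ.rho ξ e (Γ.otherWeights e) ≠ 0 := by
  rw [otherWeights, map_prod, Finset.prod_ne_zero_iff]
  intro f hf
  simp only [Finset.mem_filter, Finset.mem_univ, true_and] at hf
  rw [rho_linForm]
  exact linForm_ne_zero (rhoWt_ne_zero ξ hf.1.symm hf.2)

theorem rho_otherWeights_bar (hξ : Γ.IsPolarizing ξ) (e : E) :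
    Γ.rho ξ e (Γ.otherWeights (Γ.bar e)) = Γ.rho ξ e (Γ.otherWeights e) := by
  classical
  obtain ⟨θ, hθ⟩ := Γ.wt_congr e
  rw [otherWeights, otherWeights, map_prod, map_prod]
  rw [Finset.prod_subtype (p := fun f => Γ.src f = Γ.tgt e ∧ f ≠ Γ.bar e) _
      (by simp [Γ.src_bar]),
    Finset.prod_subtype (p := fun f => Γ.src f = Γ.src e ∧ f ≠ e) _ (by simp)]
  refine (Fintype.prod_equiv θ _ _ fun f => ?_).symm
  obtain ⟨c, hc⟩ := hθ f
  rw [hc, rho_linForm, rho_linForm, rhoWt_add_smul hξ]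

/-- With `W`, `W'` the products of the other weights at the two ends, the sum is `(f_p W' - f_q W) /
(α_e W W')`. Modulo `α_e` one has `f_p = f_q` and `W = W'`, so `α_e` divides the numerator and the
pole cancels. -/
theorem isRegularAlong_pair (hξ : Γ.IsPolarizing ξ) {f : V → SymDual n} (hf : f ∈ Γ.cohomology)
    (e : E) : Γ.IsRegularAlong ξ e
      (algebraMap (SymDual n) (QuotField n) (f (Γ.src e)) * Γ.delta (Γ.src e) +
        algebraMap (SymDual n) (QuotField n) (f (Γ.src (Γ.bar e))) *
          Γ.delta (Γ.src (Γ.bar e))) := by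
  have h1 := Γ.rho_otherWeights_ne_zero ξ e
  have h2 : Γ.rho ξ e (Γ.otherWeights (Γ.bar e)) ≠ 0 := by
    rw [rho_otherWeights_bar hξ]; exact h1
  have h3 : Γ.rho ξ e (f (Γ.src e) * Γ.otherWeights (Γ.bar e) -
      f (Γ.src (Γ.bar e)) * Γ.otherWeights e) = 0 := by
    rw [map_sub, map_mul, map_mul, rho_otherWeights_bar hξ, Γ.src_bar,
      (mem_cohomology_iff hξ).1 hf e, sub_self]
  obtain ⟨w, hw⟩ := (rho_eq_zero_iff hξ).1 h3
  rw [delta_src, delta_src, Γ.wt_bar, linForm_neg]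
  have key := ((Γ.isRegularAlong_algebraMap ξ e w).mul (isRegularAlong_inv h1)).mul
    (isRegularAlong_inv h2)
  have hw' := congrArg (algebraMap (SymDual n) (QuotField n)) hw
  have i : Function.Injective (algebraMap (SymDual n) (QuotField n)) :=
    FaithfulSMul.algebraMap_injective _ _
  have n0 : algebraMap (SymDual n) (QuotField n) (linForm (Γ.wt e)) ≠ 0 := by
    rw [Ne, map_eq_zero_iff _ i]; exact linForm_ne_zero (hξ.wt_ne_zero e)
  have n1 : algebraMap (SymDual n) (QuotField n) (Γ.otherWeights e) ≠ 0 := by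
    rw [Ne, map_eq_zero_iff _ i]; intro h; rw [h, map_zero] at h1; exact h1 rfl
  have n2 : algebraMap (SymDual n) (QuotField n) (Γ.otherWeights (Γ.bar e)) ≠ 0 := by
    rw [Ne, map_eq_zero_iff _ i]; intro h; rw [h, map_zero] at h2; exact h2 rfl
  simp only [map_sub, map_mul] at hw'
  convert key using 1
  simp only [map_mul, map_neg]
  field_simp
  linear_combination hw'

variable [Fintype V]

/-- Only vertices on an edge with weight proportional to `α_e` can contribute a pole. Pairwise
independence allows one such edge per vertex, so these vertices fall into pairs of ends. -/
theorem isRegularAlong_integral (hξ : Γ.IsPolarizing ξ) {f : V → SymDual n}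
    (hf : f ∈ Γ.cohomology) (e : E) : Γ.IsRegularAlong ξ e (Γ.integral f) := by
  classical
  let F : V → QuotField n := fun t => algebraMap (SymDual n) (QuotField n) (f t) * Γ.delta t
  let B : Finset E := Finset.univ.filter fun g => Γ.rhoWt ξ e (Γ.wt g) = 0
  have hB : ∀ g, g ∈ B ↔ Γ.rhoWt ξ e (Γ.wt g) = 0 := by simp [B]
  have hrho : ∀ g ∈ B, Γ.rho ξ g = Γ.rho ξ e := fun g hg =>
    rho_eq_of_rhoWt_eq_zero hξ ((hB g).1 hg)
  have hinj : Set.InjOn Γ.src B := by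
    intro g hg g' hg' h
    by_contra hne
    have h1 := linForm_ne_zero (rhoWt_ne_zero ξ h (Ne.symm hne))
    rw [← rho_linForm, hrho g hg, rho_linForm, (hB g').1 hg'] at h1
    exact h1 (by simp [linForm])
  have hbar : ∀ g ∈ B, Γ.bar g ∈ B := by
    intro g hg
    rw [hB] at hg ⊢
    rw [Γ.wt_bar, rhoWt_neg, hg, neg_zero]
  have hsum : ∑ g ∈ B, F (Γ.src (Γ.bar g)) = ∑ g ∈ B, F (Γ.src g) :=
    Finset.sum_nbij' Γ.bar Γ.bar hbar hbar (fun g _ => Γ.bar_bar g) (fun g _ => Γ.bar_bar g)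
      fun g _ => rfl
  have hpairs : Γ.IsRegularAlong ξ e (∑ g ∈ B, (F (Γ.src g) + F (Γ.src (Γ.bar g)))) := by
    refine isRegularAlong_sum _ _ fun g hg => ?_
    have := isRegularAlong_pair hξ hf g
    rw [IsRegularAlong, hrho g hg] at this
    exact this
  rw [Finset.sum_add_distrib, hsum, ← two_mul] at hpairs
  -- `B` contains both orientations of each edge, so the sum over pairs counts every vertex twice.
  have hhalf : ∑ g ∈ B, F (Γ.src g) =
      algebraMap (SymDual n) (QuotField n) (C 2⁻¹) * (2 * ∑ g ∈ B, F (Γ.src g)) := by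
    have : algebraMap (SymDual n) (QuotField n) (C 2⁻¹) * 2 = 1 := by
      rw [← map_ofNat (algebraMap (SymDual n) (QuotField n)) 2, ← map_mul,
        ← map_ofNat (C : ℝ →+* SymDual n) 2, ← C_mul, inv_mul_cancel₀ two_ne_zero, map_one,
        map_one]
    rw [← mul_assoc, this, one_mul]
  have hreg : Γ.IsRegularAlong ξ e (∑ t ∈ B.image Γ.src, F t) := by
    rw [Finset.sum_image hinj, hhalf]
    exact (Γ.isRegularAlong_algebraMap ξ e _).mul hpairs
  rw [integral, ← Finset.sum_add_sum_compl (B.image Γ.src)]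
  refine hreg.add (isRegularAlong_sum _ _ fun t ht => ?_)
  refine (Γ.isRegularAlong_algebraMap ξ e _).mul ?_
  rw [delta, ← map_prod]
  refine isRegularAlong_inv ?_
  rw [map_prod, Finset.prod_ne_zero_iff]
  intro g hg
  rw [rho_linForm]
  refine linForm_ne_zero fun h0 => ?_
  rw [Finset.mem_compl] at ht
  exact ht (Finset.mem_image.2 ⟨g, (hB g).2 h0, (Finset.mem_filter.1 hg).2⟩)

/-- The integral of a cohomology class is a polynomial. -/
theorem exists_algebraMap_eq_integral (hξ : Γ.IsPolarizing ξ) {f : V → SymDual n}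
    (hf : f ∈ Γ.cohomology) :
    ∃ y, algebraMap (SymDual n) (QuotField n) y = Γ.integral f := by
  classical
  refine exists_algebraMap_eq_of_forall_prime (Finset.univ : Finset E)
    (fun e => linForm (Γ.wt e)) (fun e _ => prime_linForm_wt hξ e) _ ?_ ?_
  · have : ∀ t, ∃ y, algebraMap (SymDual n) (QuotField n) y =
        algebraMap (SymDual n) (QuotField n) (∏ e, linForm (Γ.wt e)) *
          (algebraMap (SymDual n) (QuotField n) (f t) * Γ.delta t) := by
      intro t
      refine ⟨f t * ∏ e with ¬ Γ.src e = t, linForm (Γ.wt e), ?_⟩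
      rw [← Finset.prod_filter_mul_prod_filter_not Finset.univ (fun e => Γ.src e = t), delta,
        ← map_prod]
      have h0 : algebraMap (SymDual n) (QuotField n) (∏ e with Γ.src e = t, linForm (Γ.wt e)) ≠ 0 := by
        simp only [ne_eq, FaithfulSMul.algebraMap_eq_zero_iff]
        exact Finset.prod_ne_zero_iff.2 fun e _ => linForm_ne_zero (hξ.wt_ne_zero e)
      rw [map_mul, map_mul]
      field_simp
    choose y hy using this
    exact ⟨∑ t, y t, by rw [map_sum, integral, Finset.mul_sum]; simp only [hy]⟩
  · intro e _
    obtain ⟨s, hs, hy⟩ := isRegularAlong_integral hξ hf e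
    exact ⟨s, fun h => hs ((rho_eq_zero_iff hξ).2 h), hy⟩

end Finite

end GKMGraph

/-! ### Ascending paths, interpolation, and canonical Thom classes. -/

namespace GKMGraph

open MvPolynomial

variable {n d : ℕ} {V E : Type*} {Γ : GKMGraph n d V E} {ξ : Fin n → ℝ}

/-- Some ascending path joins `p` to `q`. -/
def Reaches (Γ : GKMGraph n d V E) (ξ : Fin n → ℝ) (p q : V) : Prop :=
  ∃ γ, Γ.IsAscPath ξ p γ q

theorem isAscPath_append {p r : V} {γ γ' : List E} :
    Γ.IsAscPath ξ p (γ ++ γ') r ↔ ∃ q, Γ.IsAscPath ξ p γ q ∧ Γ.IsAscPath ξ q γ' r := by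
  induction γ generalizing p with
  | nil => simp [IsAscPath]
  | cons e l ih => simp only [List.cons_append, IsAscPath, ih]; tauto

theorem isAscPath_concat {p q : V} {γ : List E} {e : E} :
    Γ.IsAscPath ξ p (γ ++ [e]) q ↔
      Γ.IsAscPath ξ p γ (Γ.src e) ∧ Γ.IsAscending ξ e ∧ Γ.tgt e = q := by
  simp only [isAscPath_append, IsAscPath]
  constructor
  · rintro ⟨r, h, rfl, h2, h3⟩; exact ⟨h, h2, h3⟩
  · rintro ⟨h, h2, h3⟩; exact ⟨_, h, rfl, h2, h3⟩

theorem isAscending_bar {e : E} : Γ.IsAscending ξ (Γ.bar e) ↔ Γ.wt e ⬝ᵥ ξ < 0 := by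
  rw [IsAscending, wt_bar_dotProduct, Left.neg_pos_iff]

theorem isAscending_neg_bar {e : E} : Γ.IsAscending (-ξ) (Γ.bar e) ↔ Γ.IsAscending ξ e := by
  rw [isAscending_bar, IsAscending, dotProduct_neg, neg_lt_zero]

theorem IsAscPath.reverse {p q : V} {γ : List E} (h : Γ.IsAscPath ξ p γ q) :
    Γ.IsAscPath (-ξ) q (γ.reverse.map Γ.bar) p := by
  induction γ generalizing p with
  | nil => exact Eq.symm h
  | cons e l ih =>
    rw [List.reverse_cons, List.map_append, List.map_singleton, isAscPath_concat]
    exact ⟨by rw [Γ.src_bar]; exact ih h.2.2, isAscending_neg_bar.2 h.2.1,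
      by rw [tgt_bar]; exact h.1⟩

theorem Reaches.refl (Γ : GKMGraph n d V E) (ξ : Fin n → ℝ) (p : V) : Γ.Reaches ξ p p := ⟨[], rfl⟩

theorem Reaches.trans {p q r : V} (h : Γ.Reaches ξ p q) (h' : Γ.Reaches ξ q r) :
    Γ.Reaches ξ p r := by
  obtain ⟨γ, h⟩ := h
  obtain ⟨γ', h'⟩ := h'
  exact ⟨_, isAscPath_append.2 ⟨q, h, h'⟩⟩

theorem Reaches.neg {p q : V} (h : Γ.Reaches ξ p q) : Γ.Reaches (-ξ) q p := by
  obtain ⟨γ, h⟩ := h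
  exact ⟨_, h.reverse⟩

theorem reaches_neg_iff {p q : V} : Γ.Reaches (-ξ) q p ↔ Γ.Reaches ξ p q :=
  ⟨fun h => by simpa using h.neg, Reaches.neg⟩

theorem IsMorse.neg {φ : V → ℝ} (hφ : Γ.IsMorse ξ φ) : Γ.IsMorse (-ξ) (-φ) := by
  intro e he
  have h := hφ (Γ.bar e) (by rw [isAscending_bar]; simpa [IsAscending] using he)
  rw [Γ.src_bar, tgt_bar] at h
  simpa using h

theorem IsMorse.lt_of_isAscPath {φ : V → ℝ} (hφ : Γ.IsMorse ξ φ) {p q : V} {γ : List E}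
    (h : Γ.IsAscPath ξ p γ q) (hγ : γ ≠ []) : φ p < φ q := by
  induction γ generalizing p with
  | nil => exact absurd rfl hγ
  | cons e l ih =>
    obtain ⟨rfl, he, hl⟩ := h
    have h1 := hφ e he
    by_cases h0 : l = []
    · subst h0; rw [IsAscPath] at hl; rwa [hl] at h1
    · exact h1.trans (ih hl h0)

theorem IsMorse.lt_of_reaches {φ : V → ℝ} (hφ : Γ.IsMorse ξ φ) {p q : V} (h : Γ.Reaches ξ p q)
    (hne : p ≠ q) : φ p < φ q := by
  obtain ⟨γ, h⟩ := h
  refine hφ.lt_of_isAscPath h ?_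
  rintro rfl
  exact hne h

theorem IsMorse.reaches_antisymm {φ : V → ℝ} (hφ : Γ.IsMorse ξ φ) {p q : V}
    (h : Γ.Reaches ξ p q) (h' : Γ.Reaches ξ q p) : p = q := by
  by_contra hne
  exact lt_asymm (hφ.lt_of_reaches h hne) (hφ.lt_of_reaches h' (Ne.symm hne))

section Finite

variable [Fintype E]

theorem IndexIncreasing.neg (hξ : Γ.IsPolarizing ξ) (h : Γ.IndexIncreasing ξ) :
    Γ.IndexIncreasing (-ξ) := by
  intro p q γ hγ hne
  have h1 := hγ.reverse
  rw [neg_neg] at h1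
  have h2 := h q p _ h1 (by simpa using hne)
  have h3 := index_add_index_neg hξ p
  have h4 := index_add_index_neg hξ q
  omega

theorem IndexIncreasing.index_lt (h : Γ.IndexIncreasing ξ) {p q : V} (hpq : Γ.Reaches ξ p q)
    (hne : p ≠ q) : Γ.index ξ p < Γ.index ξ q := by
  obtain ⟨γ, hγ⟩ := hpq
  refine h p q γ hγ ?_
  rintro rfl
  exact hne hγ

theorem reaches_of_mem_descEdges {q : V} {e : E} (he : e ∈ Γ.descEdges ξ q) :
    Γ.Reaches ξ (Γ.tgt e) q := by
  obtain ⟨rfl, h⟩ := mem_descEdges.1 he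
  exact ⟨[Γ.bar e], Γ.src_bar e, isAscending_bar.2 h, Γ.tgt_bar e⟩

theorem IsMorse.lt_of_mem_descEdges {φ : V → ℝ} (hφ : Γ.IsMorse ξ φ) {q : V} {e : E}
    (he : e ∈ Γ.descEdges ξ q) : φ (Γ.tgt e) < φ q := by
  obtain ⟨rfl, h⟩ := mem_descEdges.1 he
  have := hφ (Γ.bar e) (isAscending_bar.2 h)
  rwa [Γ.src_bar, tgt_bar] at this

/-! ### The interpolation formula -/

open Classical in
/-- The interpolated value at `q` of the restriction of `τ` to the lower ends of the descending
edges at `q`. -/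
noncomputable def interp (Γ : GKMGraph n d V E) (ξ : Fin n → ℝ) (τ : V → SymDual n) (q : V) :
    QuotField n :=
  ∑ e ∈ Γ.descEdges ξ q,
    (∏ f ∈ (Γ.descEdges ξ q).erase e,
      algebraMap (SymDual n) (QuotField n) (linForm (Γ.wt f)) /
        algebraMap (SymDual n) (QuotField n) (linForm (Γ.rhoWt ξ e (Γ.wt f)))) *
    algebraMap (SymDual n) (QuotField n) (Γ.rho ξ e (τ (Γ.tgt e)))

theorem interp_congr {τ τ' : V → SymDual n} {q : V}
    (h : ∀ e ∈ Γ.descEdges ξ q, τ (Γ.tgt e) = τ' (Γ.tgt e)) :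
    Γ.interp ξ τ q = Γ.interp ξ τ' q :=
  Finset.sum_congr rfl fun e he => by rw [h e he]

theorem interp_eq_zero {τ : V → SymDual n} {q : V}
    (h : ∀ e ∈ Γ.descEdges ξ q, τ (Γ.tgt e) = 0) : Γ.interp ξ τ q = 0 :=
  Finset.sum_eq_zero fun e he => by rw [h e he, map_zero, map_zero, mul_zero]

theorem dilateQuot_interp (Γ : GKMGraph n d V E) (ξ : Fin n → ℝ) (τ : V → SymDual n) (q : V) :
    dilateQuot n (Γ.interp ξ τ q) = Γ.interp ξ (fun t => dilate n (τ t)) q := by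
  have h2 : algebraMap (SymDual n) (QuotField n) (C 2) ≠ 0 := by simp
  simp only [interp, map_sum, map_mul, map_prod, map_div₀, dilateQuot_algebraMap, dilate_linForm,
    dilate_rho, mul_div_mul_left _ _ h2]

theorem interp_C_mul (Γ : GKMGraph n d V E) (ξ : Fin n → ℝ) (c : ℝ) (τ : V → SymDual n) (q : V) :
    Γ.interp ξ (fun t => C c * τ t) q =
      algebraMap (SymDual n) (QuotField n) (C c) * Γ.interp ξ τ q := by
  rw [interp, interp, Finset.mul_sum]
  refine Finset.sum_congr rfl fun e _ => ?_
  rw [map_mul, algHom_C, map_mul]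
  exact mul_left_comm _ _ _

/-- One-variable interpolation of `H(s) = τ(q)(x + sξ)` at the nodes `s = -α̂_e`, evaluated at `s =
0`. The value at such a node is `ρ_e(τ(q))`, which equals `ρ_e(τ(t(e)))` because `τ` is a class. -/
theorem exists_sub_mul_nu_eq_interp (hξ : Γ.IsPolarizing ξ) {τ : V → SymDual n}
    (hτ : τ ∈ Γ.cohomology) (q : V) :
    ∃ k, algebraMap (SymDual n) (QuotField n) (τ q - k * Γ.nu ξ q) = Γ.interp ξ τ q := by
  classical
  let a : E → SymDual n := fun e => C (Γ.wt e ⬝ᵥ ξ)⁻¹ * linForm (Γ.wt e)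
  have hwt : ∀ f, linForm (Γ.wt f) = C (Γ.wt f ⬝ᵥ ξ) * a f := by
    intro f
    rw [← mul_assoc, ← C_mul, mul_inv_cancel₀ (hξ f), C_1, one_mul]
  have hrho : ∀ e f, linForm (Γ.rhoWt ξ e (Γ.wt f)) = C (Γ.wt f ⬝ᵥ ξ) * (a f - a e) := by
    intro e f
    rw [mul_sub, ← hwt, rhoWt, linForm_sub, linForm_smul, div_eq_mul_inv, C_mul, mul_assoc]
  let H : Polynomial (SymDual n) := shift ξ (-Polynomial.X : Polynomial (SymDual n)) (τ q)
  have hH : ∀ v, H.eval v = shift ξ (-v) (τ q) := by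
    intro v
    have := map_shift ξ
      ((Polynomial.aeval v : Polynomial (SymDual n) →ₐ[SymDual n] SymDual n).restrictScalars ℝ)
      (fun p => by
        rw [AlgHom.restrictScalars_apply, AlgHom.commutes]) (-Polynomial.X) (τ q)
    rw [map_neg, AlgHom.restrictScalars_apply, AlgHom.restrictScalars_apply, Polynomial.aeval_X,
      Polynomial.coe_aeval_eq_eval] at this
    exact this
  -- The nodes are distinct because the weights at `q` are pairwise independent.
  obtain ⟨k, hk⟩ := exists_eval_zero_sub_eq_interpolation (K := QuotField n) H
    (Γ.descEdges ξ q) (fun e => -a e) (by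
      intro e he f hf hef
      by_contra hne
      refine linForm_ne_zero (rhoWt_ne_zero ξ ((mem_descEdges.1 he).1.trans
        (mem_descEdges.1 hf).1.symm) (Ne.symm hne)) ?_
      rw [hrho, neg_injective hef, sub_self, mul_zero])
  refine ⟨k * C (∏ e ∈ Γ.descEdges ξ q, (Γ.wt e ⬝ᵥ ξ)⁻¹), ?_⟩
  rw [hH, neg_zero, shift_zero] at hk
  have hnu : ∏ e ∈ Γ.descEdges ξ q, (- -a e) =
      C (∏ e ∈ Γ.descEdges ξ q, (Γ.wt e ⬝ᵥ ξ)⁻¹) * Γ.nu ξ q := by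
    rw [nu, map_prod, ← Finset.prod_mul_distrib]
    exact Finset.prod_congr rfl fun e _ => neg_neg _
  rw [hnu, ← mul_assoc] at hk
  refine Eq.trans hk ?_
  rw [interp]
  refine Finset.sum_congr rfl fun e he => ?_
  have hval : H.eval (-a e) = Γ.rho ξ e (τ (Γ.tgt e)) := by
    rw [← (mem_cohomology_iff hξ).1 hτ e, (mem_descEdges.1 he).1, hH, neg_neg, rho_eq_shift]
  rw [hval]
  congr 1
  refine Finset.prod_congr rfl fun f _ => ?_
  have hc : algebraMap (SymDual n) (QuotField n) (C (Γ.wt f ⬝ᵥ ξ)) ≠ 0 := by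
    simpa using hξ f
  rw [hwt f, hrho e f, map_mul _ _ (a f), map_mul _ _ (a f - a e),
    mul_div_mul_left _ _ hc, neg_neg, ← map_sub]
  congr 2
  ring

/-- The quotient in `exists_sub_mul_nu_eq_interp` is homogeneous. -/
theorem exists_homogeneous_sub_mul_nu_eq_interp (hξ : Γ.IsPolarizing ξ) {τ : V → SymDual n}
    (hτ : τ ∈ Γ.cohomology) {m : ℕ} (hm : ∀ q, (τ q).IsHomogeneous m) (q : V) :
    ∃ k, algebraMap (SymDual n) (QuotField n) (τ q - k * Γ.nu ξ q) = Γ.interp ξ τ q ∧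
      C (2 ^ Γ.index ξ q) * dilate n k = C (2 ^ m) * k := by
  obtain ⟨k, hk⟩ := exists_sub_mul_nu_eq_interp hξ hτ q
  refine ⟨k, hk, ?_⟩
  have h1 := congrArg (dilateQuot n) hk
  rw [dilateQuot_interp, dilateQuot_algebraMap] at h1
  have h2 : Γ.interp ξ (fun t => dilate n (τ t)) q = Γ.interp ξ (fun t => C (2 ^ m) * τ t) q :=
    interp_congr fun e _ => dilate_eq_of_isHomogeneous (hm _)
  rw [h2, interp_C_mul, ← hk, ← map_mul, map_sub, map_mul, dilate_eq_of_isHomogeneous (hm q),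
    dilate_eq_of_isHomogeneous (Γ.isHomogeneous_nu ξ q)] at h1
  have h3 := FaithfulSMul.algebraMap_injective (SymDual n) (QuotField n) h1
  apply mul_right_cancel₀ (nu_ne_zero hξ q)
  linear_combination -h3

theorem IsThomClass.eq_zero {p q : V} {τ : V → SymDual n} (h : Γ.IsThomClass ξ p τ)
    (hpq : ¬ Γ.Reaches ξ p q) : τ q = 0 := by
  by_contra h0
  exact hpq (h.support q h0)

theorem IsThomClass.interp_eq_of_not_reaches {p q : V} {τ : V → SymDual n}
    (h : Γ.IsThomClass ξ p τ) (hpq : ¬ Γ.Reaches ξ p q) :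
    algebraMap (SymDual n) (QuotField n) (τ q) = Γ.interp ξ τ q := by
  rw [h.eq_zero hpq, map_zero, interp_eq_zero fun e he => h.eq_zero fun h' =>
    hpq (h'.trans (reaches_of_mem_descEdges he))]

/-- The hypothesis on `k` stands for degree `b - a`; it also covers `b < a`, where it forces `k =
0`. -/
theorem isHomogeneous_mul_of_dilate {τ k : SymDual n} {a b : ℕ} (hτ : τ.IsHomogeneous a)
    (hk : C (2 ^ a) * dilate n k = C (2 ^ b) * k) : (k * τ).IsHomogeneous b := by
  refine isHomogeneous_of_dilate_eq (k := 0) ?_ (add_zero b)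
  rw [map_mul, dilate_eq_of_isHomogeneous hτ, pow_zero, C_1, one_mul]
  linear_combination τ * hk

/-- If every vertex has a Thom class, then it has a canonical one. -/
theorem exists_isCanonicalThomClass [Finite V] (hξ : Γ.IsPolarizing ξ) {φ : V → ℝ}
    (hφ : Γ.IsMorse ξ φ) (hT : ∀ p, ∃ τ, Γ.IsThomClass ξ p τ) (p : V) :
    ∃ τ, Γ.IsCanonicalThomClass ξ p τ := by
  classical
  have := Fintype.ofFinite V
  suffices h : ∀ s : Finset V, ∃ τ, Γ.IsThomClass ξ p τ ∧ ∀ q ∈ s, q ≠ p →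
      algebraMap (SymDual n) (QuotField n) (τ q) = Γ.interp ξ τ q by
    obtain ⟨τ, h1, h2⟩ := h Finset.univ
    exact ⟨τ, h1, fun q hq => h2 q (Finset.mem_univ q) hq⟩
  intro s
  -- Vertices are corrected in order of increasing `φ`. Ties do no harm: a Thom class of `a`
  -- vanishes at every other vertex of height at most `φ a`.
  induction s using Finset.induction_on_max_value φ with
  | empty =>
    obtain ⟨τ, h⟩ := hT p
    exact ⟨τ, h, by simp⟩
  | insert a s ha hs ih =>
    obtain ⟨τ, h1, h2⟩ := ih
    by_cases hpa : Γ.Reaches ξ p a ∧ a ≠ p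
    · obtain ⟨hpa, hne⟩ := hpa
      obtain ⟨η, hη⟩ := hT a
      obtain ⟨k, hk, hk'⟩ := exists_homogeneous_sub_mul_nu_eq_interp hξ h1.mem h1.homogeneous a
      have hlow : ∀ q, φ q ≤ φ a → q ≠ a → η q = 0 := fun q hq hqa => hη.eq_zero fun h =>
        absurd (hφ.lt_of_reaches h hqa.symm) (not_lt.2 hq)
      have hval : ∀ q, φ q ≤ φ a → q ≠ a → (τ - k • η) q = τ q := by
        intro q hq hqa
        rw [Pi.sub_apply, Pi.smul_apply, hlow q hq hqa, smul_zero, sub_zero]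
      have hint : ∀ q, φ q ≤ φ a → Γ.interp ξ (τ - k • η) q = Γ.interp ξ τ q := by
        intro q hq
        refine interp_congr fun e he => ?_
        have hlt := (hφ.lt_of_mem_descEdges he).trans_le hq
        exact hval _ hlt.le fun h => by rw [h] at hlt; exact lt_irrefl _ hlt
      refine ⟨τ - k • η, ⟨sub_mem h1.mem (Subalgebra.smul_mem _ hη.mem k), ?_, ?_, ?_⟩, ?_⟩
      · intro q
        exact (h1.homogeneous q).sub (isHomogeneous_mul_of_dilate (hη.homogeneous q) hk')
      · intro q hq
        by_cases h0 : τ q = 0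
        · refine hpa.trans (hη.support q fun h => hq ?_)
          rw [Pi.sub_apply, Pi.smul_apply, h0, h, smul_zero, sub_zero]
        · exact h1.support q h0
      · rw [hval p (hφ.lt_of_reaches hpa hne.symm).le hne.symm, h1.value]
      · intro q hq hqp
        rw [Finset.mem_insert] at hq
        rcases hq with rfl | hq
        · rw [hint q le_rfl, ← hk, Pi.sub_apply, Pi.smul_apply, hη.value, smul_eq_mul]
        · rw [hint q (hs q hq), hval q (hs q hq) (by rintro rfl; exact ha hq), h2 q hq hqp]
    · refine ⟨τ, h1, fun q hq hqp => ?_⟩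
      rw [Finset.mem_insert] at hq
      rcases hq with rfl | hq
      · exact h1.interp_eq_of_not_reaches fun h => hpa ⟨h, hqp⟩
      · exact h2 q hq hqp

/-- At a lowest vertex of disagreement, interpolation uses only strictly lower vertices, where the
two classes agree. -/
theorem IsCanonicalThomClass.eq [Finite V] {φ : V → ℝ} (hφ : Γ.IsMorse ξ φ) {p : V}
    {τ τ' : V → SymDual n} (h : Γ.IsCanonicalThomClass ξ p τ)
    (h' : Γ.IsCanonicalThomClass ξ p τ') : τ = τ' := by
  by_contra hne
  obtain ⟨q₀, hq₀⟩ := Function.ne_iff.1 hne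
  obtain ⟨q, hq, hmin⟩ := Set.exists_min_image {q | τ q ≠ τ' q} φ (Set.toFinite _) ⟨q₀, hq₀⟩
  apply hq
  by_cases hqp : q = p
  · rw [hqp, h.value, h'.value]
  · apply FaithfulSMul.algebraMap_injective (SymDual n) (QuotField n)
    refine (h.interpolation q hqp).trans (Eq.trans ?_ (h'.interpolation q hqp).symm)
    refine interp_congr fun e he => ?_
    by_contra hne'
    exact absurd (hφ.lt_of_mem_descEdges he) (not_lt.2 (hmin _ hne'))

/-- If the index increases along ascending paths, then every Thom class is canonical. -/
theorem IsThomClass.isCanonicalThomClass (hξ : Γ.IsPolarizing ξ) (hinc : Γ.IndexIncreasing ξ)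
    {p : V} {τ : V → SymDual n} (h : Γ.IsThomClass ξ p τ) : Γ.IsCanonicalThomClass ξ p τ := by
  refine ⟨h, fun q hqp => ?_⟩
  by_cases hpq : Γ.Reaches ξ p q
  · obtain ⟨k, hk, hk'⟩ := exists_homogeneous_sub_mul_nu_eq_interp hξ h.mem h.homogeneous q
    -- The correction `k` would have degree `σ_p - σ_q < 0`.
    rw [eq_zero_of_dilate_eq hk' (hinc.index_lt hpq (Ne.symm hqp)), zero_mul, sub_zero] at hk
    exact hk
  · exact h.interp_eq_of_not_reaches hpq

end Finite

end GKMGraph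

/-! ### Poincaré duality and Thom classes for `-ξ`. -/

namespace GKMGraph

open MvPolynomial

variable {n d : ℕ} {V E : Type*} {Γ : GKMGraph n d V E} {ξ : Fin n → ℝ}

section Finite

variable [Fintype E]

theorem nu_neg_of_mul (hξ : Γ.IsPolarizing ξ) {p : V} {x : SymDual n}
    (h : algebraMap (SymDual n) (QuotField n) (Γ.nu ξ p * x) * Γ.delta p = 1) :
    x = Γ.nu (-ξ) p := by
  have h1 : algebraMap (SymDual n) (QuotField n) (Γ.nu ξ p * Γ.nu (-ξ) p) ≠ 0 := by
    simpa using ⟨nu_ne_zero hξ p, nu_ne_zero hξ.neg p⟩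
  rw [delta_eq hξ, mul_inv_eq_one₀ h1] at h
  exact mul_left_cancel₀ (nu_ne_zero hξ p)
    (FaithfulSMul.algebraMap_injective (SymDual n) (QuotField n) h)

variable [Fintype V]

theorem integral_smul (Γ : GKMGraph n d V E) (c : SymDual n) (f : V → SymDual n) :
    Γ.integral (c • f) = algebraMap (SymDual n) (QuotField n) c * Γ.integral f := by
  simp [integral, Finset.mul_sum, mul_assoc]

theorem integral_sub (Γ : GKMGraph n d V E) (f g : V → SymDual n) :
    Γ.integral (f - g) = Γ.integral f - Γ.integral g := by
  simp [integral, sub_mul, Finset.sum_sub_distrib]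

theorem integral_sum (Γ : GKMGraph n d V E) {ι : Type*} (s : Finset ι) (f : ι → V → SymDual n) :
    Γ.integral (∑ i ∈ s, f i) = ∑ i ∈ s, Γ.integral (f i) := by
  simp only [integral, Finset.sum_apply, map_sum, Finset.sum_mul]
  exact Finset.sum_comm

/-- Integration lowers degrees by `d`, since exactly `d` edges start at each vertex. -/
theorem dilateQuot_integral (hξ : Γ.IsPolarizing ξ) (f : V → SymDual n) :
    algebraMap (SymDual n) (QuotField n) (C (2 ^ d)) * dilateQuot n (Γ.integral f) =
      Γ.integral fun t => dilate n (f t) := by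
  rw [integral, integral, map_sum, Finset.mul_sum]
  refine Finset.sum_congr rfl fun t _ => ?_
  have h2 : algebraMap (SymDual n) (QuotField n) (C (2 ^ d)) ≠ 0 := by simp
  rw [map_mul, dilateQuot_algebraMap, delta_eq hξ, map_inv₀, dilateQuot_algebraMap, map_mul,
    dilate_eq_of_isHomogeneous (Γ.isHomogeneous_nu ξ t),
    dilate_eq_of_isHomogeneous (Γ.isHomogeneous_nu (-ξ) t), mul_mul_mul_comm, ← C_mul, ← pow_add,
    index_add_index_neg hξ, map_mul, mul_inv]
  field_simp

/-- Triangularity of Thom classes: a function that is orthogonal to the Thom classes of an upwards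
closed set of vertices vanishes on this set. -/
theorem eq_zero_of_integral_eq_zero (hξ : Γ.IsPolarizing ξ) {φ : V → ℝ} (hφ : Γ.IsMorse ξ φ)
    {τ : V → V → SymDual n} (hτ : ∀ p, Γ.IsThomClass ξ p (τ p)) {h : V → SymDual n}
    (P : V → Prop) (hP : ∀ t u, P t → Γ.Reaches ξ t u → P u)
    (hint : ∀ t, P t → Γ.integral (τ t * h) = 0) (t : V) (ht : P t) : h t = 0 := by
  by_contra h0
  obtain ⟨q, ⟨hqP, hq⟩, hmax⟩ := Set.exists_max_image {t | P t ∧ h t ≠ 0} φ (Set.toFinite _)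
    ⟨t, ht, h0⟩
  have h1 := hint q hqP
  -- At a highest vertex `q` of the set with `h q ≠ 0`, the factor `τ q` vanishes off the vertices
  -- above `q`, and `h` vanishes at those above and different from `q`.
  rw [integral, Finset.sum_eq_single q] at h1
  · rw [Pi.mul_apply, (hτ q).value, map_mul] at h1
    have hn : algebraMap (SymDual n) (QuotField n) (Γ.nu ξ q) ≠ 0 := by
      simpa using nu_ne_zero hξ q
    have hq' : algebraMap (SymDual n) (QuotField n) (h q) ≠ 0 := by simpa using hq
    exact mul_ne_zero (mul_ne_zero hn hq') (delta_ne_zero hξ q) h1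
  · intro u _ huq
    rw [Pi.mul_apply]
    by_cases hr : Γ.Reaches ξ q u
    · have hu : h u = 0 := by
        by_contra hu
        exact absurd (hφ.lt_of_reaches hr (Ne.symm huq)) (not_lt.2 (hmax u ⟨hP q u hqP hr, hu⟩))
      rw [hu, mul_zero, map_zero, zero_mul]
    · rw [(hτ q).eq_zero hr, zero_mul, map_zero, zero_mul]
  · exact fun h => absurd (Finset.mem_univ q) h

theorem eq_zero_of_forall_integral_eq_zero (hξ : Γ.IsPolarizing ξ) {φ : V → ℝ}
    (hφ : Γ.IsMorse ξ φ) {τ : V → V → SymDual n} (hτ : ∀ p, Γ.IsThomClass ξ p (τ p))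
    {h : V → SymDual n} (hint : ∀ t, Γ.integral (τ t * h) = 0) : h = 0 :=
  funext fun t => eq_zero_of_integral_eq_zero hξ hφ hτ (fun _ => True) (fun _ _ _ _ => trivial)
    (fun t _ => hint t) t trivial

theorem prod_nu (Γ : GKMGraph n d V E) (ξ : Fin n → ℝ) :
    ∏ p, Γ.nu ξ p = ∏ e with Γ.wt e ⬝ᵥ ξ < 0, linForm (Γ.wt e) := by
  classical
  rw [← Finset.prod_fiberwise _ Γ.src]
  refine Finset.prod_congr rfl fun p _ => ?_
  rw [nu]
  refine Finset.prod_congr ?_ fun _ _ => rfl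
  ext e
  simp [mem_descEdges, and_comm]

/-- Reversal matches ascending with descending edges and changes the sign of each weight. -/
theorem prod_nu_neg (Γ : GKMGraph n d V E) (ξ : Fin n → ℝ) :
    ∃ N : ℕ, ∏ p, Γ.nu (-ξ) p = (-1) ^ N * ∏ p, Γ.nu ξ p := by
  classical
  refine ⟨Finset.card {e | Γ.wt e ⬝ᵥ ξ < 0}, ?_⟩
  rw [prod_nu, prod_nu, ← Finset.prod_neg]
  refine Finset.prod_nbij' Γ.bar Γ.bar ?_ ?_ (fun e _ => Γ.bar_bar e) (fun e _ => Γ.bar_bar e)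
    ?_
  · intro e he
    simpa [wt_bar_dotProduct] using he
  · intro e he
    simpa [wt_bar_dotProduct] using he
  · intro e _
    rw [Γ.wt_bar, linForm_neg, neg_neg]

theorem det_thomClasses [DecidableEq V] {φ : V → ℝ} (hφ : Γ.IsMorse ξ φ)
    {τ : V → V → SymDual n} (hτ : ∀ p, Γ.IsThomClass ξ p (τ p)) :
    (Matrix.of τ).det = ∏ p, Γ.nu ξ p := by
  -- `φ` need not be injective; an arbitrary numbering breaks ties and gives a linear order in which
  -- the matrix is triangular.
  let g : V → ℝ ×ₗ Fin (Fintype.card V) := fun v => toLex (φ v, Fintype.equivFin V v)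
  have hg : Function.Injective g := fun v w h =>
    (Fintype.equivFin V).injective (congrArg (fun x => (ofLex x).2) h)
  let _ : LinearOrder V := LinearOrder.lift' g hg
  have htri : (Matrix.of τ).IsUpperTriangular := by
    intro p q hqp
    refine (hτ p).eq_zero fun hr => ?_
    have hqp' : g q < g p := hqp
    have hpq : g p < g q := Prod.Lex.toLex_lt_toLex.2 (Or.inl (hφ.lt_of_reaches hr (by
      rintro rfl; exact lt_irrefl _ hqp')))
    exact lt_asymm hpq hqp'
  have := Matrix.det_of_isUpperTriangular htri
  refine Eq.trans ?_ (this.trans (Finset.prod_congr rfl fun p _ => (hτ p).value))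
  congr!

/-- Poincaré duality: the Thom classes have a dual basis in the cohomology ring. -/
theorem exists_dual [DecidableEq V] (hξ : Γ.IsPolarizing ξ) {φ : V → ℝ} (hφ : Γ.IsMorse ξ φ)
    {τ : V → V → SymDual n} (hτ : ∀ p, Γ.IsThomClass ξ p (τ p)) :
    ∃ η : V → V → SymDual n, (∀ p, η p ∈ Γ.cohomology) ∧
      ∀ p q, Γ.integral (τ p * η q) = if p = q then 1 else 0 := by
  choose G hG using fun p q =>
    exists_algebraMap_eq_integral hξ (mul_mem (hτ p).mem (hτ q).mem)
  have i : Function.Injective (algebraMap (SymDual n) (QuotField n)) :=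
    FaithfulSMul.algebraMap_injective _ _
  -- The Gram matrix is `T D Tᵀ` with `det T = ∏ ν_p⁺` and `det D = ∏ (ν_p⁺ ν_p⁻)⁻¹`. As `∏ ν_p⁻ = ±
  -- ∏ ν_p⁺`, its determinant is `±1`, so its inverse has polynomial entries.
  have hdet : IsUnit (Matrix.of G).det := by
    have h1 : (algebraMap (SymDual n) (QuotField n)).mapMatrix (Matrix.of G) =
        (algebraMap (SymDual n) (QuotField n)).mapMatrix (Matrix.of τ) *
          Matrix.diagonal Γ.delta *
            ((algebraMap (SymDual n) (QuotField n)).mapMatrix (Matrix.of τ))ᵀ := by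
      ext p q
      rw [Matrix.mul_apply]
      simp only [Matrix.mul_diagonal, RingHom.mapMatrix_apply, Matrix.map_apply, Matrix.of_apply,
        hG, integral, Matrix.transpose_apply, Pi.mul_apply, map_mul]
      exact Finset.sum_congr rfl fun t _ => by ring
    have h2 := congrArg Matrix.det h1
    rw [Matrix.det_mul, Matrix.det_mul, Matrix.det_transpose, Matrix.det_diagonal,
      ← RingHom.map_det, ← RingHom.map_det, det_thomClasses hφ hτ] at h2
    obtain ⟨N, hN⟩ := Γ.prod_nu_neg ξ
    have h3 : ∏ p, Γ.delta p =
        (algebraMap (SymDual n) (QuotField n) ((∏ p, Γ.nu ξ p) * ((-1) ^ N * ∏ p, Γ.nu ξ p)))⁻¹ := by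
      rw [← hN, ← Finset.prod_mul_distrib, map_prod, ← Finset.prod_inv_distrib]
      exact Finset.prod_congr rfl fun p _ => delta_eq hξ p
    have h4 : algebraMap (SymDual n) (QuotField n) (∏ p, Γ.nu ξ p) ≠ 0 := by
      rw [Ne, map_eq_zero_iff _ i]
      exact Finset.prod_ne_zero_iff.2 fun p _ => nu_ne_zero hξ p
    have h5 : (Matrix.of G).det * (-1) ^ N = 1 := by
      apply i
      rw [map_mul, h2, h3]
      simp only [map_mul, map_one]
      have h6 : algebraMap (SymDual n) (QuotField n) ((-1) ^ N) ≠ 0 := by simp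
      field_simp
    exact IsUnit.of_mul_eq_one _ h5
  refine ⟨fun p => ∑ q, (Matrix.of G)⁻¹ p q • τ q, fun p => sum_mem fun q _ =>
    Subalgebra.smul_mem _ (hτ q).mem _, fun p q => ?_⟩
  have h1 : τ p * ∑ r, (Matrix.of G)⁻¹ q r • τ r = ∑ r, (Matrix.of G)⁻¹ q r • (τ r * τ p) := by
    rw [Finset.mul_sum]
    exact Finset.sum_congr rfl fun r _ => by rw [mul_smul_comm, mul_comm]
  rw [h1, integral_sum]
  have h2 : ∑ r, Γ.integral ((Matrix.of G)⁻¹ q r • (τ r * τ p)) =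
      algebraMap (SymDual n) (QuotField n) (((Matrix.of G)⁻¹ * Matrix.of G) q p) := by
    rw [Matrix.mul_apply, map_sum]
    refine Finset.sum_congr rfl fun r _ => ?_
    rw [integral_smul, ← hG, map_mul, Matrix.of_apply]
  rw [h2, Matrix.nonsing_inv_mul _ hdet, Matrix.one_apply]
  simp only [eq_comm (a := q)]
  split_ifs <;> simp

/-- Only `p` contributes to an integral that is supported above and below `p`. -/
theorem integral_eq_of_support {φ : V → ℝ} (hφ : Γ.IsMorse ξ φ) {p : V} {f g : V → SymDual n}
    (hf : ∀ t, ¬ Γ.Reaches ξ p t → f t = 0) (hg : ∀ t, ¬ Γ.Reaches ξ t p → g t = 0) :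
    Γ.integral (f * g) = algebraMap (SymDual n) (QuotField n) (f p * g p) * Γ.delta p := by
  rw [integral, Finset.sum_eq_single p]
  · rfl
  · intro t _ htp
    rw [Pi.mul_apply]
    by_cases h1 : Γ.Reaches ξ p t
    · rw [hg t fun h2 => htp (hφ.reaches_antisymm h2 h1), mul_zero, map_zero, zero_mul]
    · rw [hf t h1, zero_mul, map_zero, zero_mul]
  · exact fun h => absurd (Finset.mem_univ p) h

/-- If all vertices have Thom classes for `ξ`, then they also have Thom classes for `-ξ`. -/
theorem exists_isThomClass_neg (hξ : Γ.IsPolarizing ξ) {φ : V → ℝ} (hφ : Γ.IsMorse ξ φ)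
    (hT : ∀ p, ∃ τ, Γ.IsThomClass ξ p τ) (p : V) : ∃ η, Γ.IsThomClass (-ξ) p η := by
  classical
  choose τ hτ using hT
  obtain ⟨η, hη, hdual⟩ := exists_dual hξ hφ hτ
  have hsupp : ∀ t, ¬ Γ.Reaches ξ t p → η p t = 0 :=
    eq_zero_of_integral_eq_zero hξ hφ hτ (fun t => ¬ Γ.Reaches ξ t p)
      (fun t u h1 h2 h3 => h1 (h2.trans h3)) fun t ht => by
        rw [hdual, if_neg]
        rintro rfl
        exact ht (Reaches.refl Γ ξ t)
  refine ⟨η p, hη p, fun q => ?_, fun q hq => ?_, ?_⟩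
  -- Homogeneity of degree `d - σ_p` comes from uniqueness: the suitably scaled dilate of `η p` has
  -- the same integrals against all `τ t`.
  · have key : (fun t => C (2 ^ Γ.index ξ p) * dilate n (η p t) - C (2 ^ d) * η p t) = 0 := by
      refine eq_zero_of_forall_integral_eq_zero hξ hφ hτ fun t => ?_
      have h1 := dilateQuot_integral hξ (τ t * η p)
      have h2 : (fun u => dilate n ((τ t * η p) u)) =
          (C (2 ^ Γ.index ξ t) : SymDual n) • (τ t * fun u => dilate n (η p u)) := by
        funext u
        rw [Pi.mul_apply, map_mul, dilate_eq_of_isHomogeneous ((hτ t).homogeneous u)]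
        exact mul_assoc _ _ _
      have h3 : τ t * (fun u => C (2 ^ Γ.index ξ p) * dilate n (η p u) - C (2 ^ d) * η p u) =
          (C (2 ^ Γ.index ξ p) : SymDual n) • (τ t * fun u => dilate n (η p u)) -
            (C (2 ^ d) : SymDual n) • (τ t * η p) := by
        funext u
        simp only [Pi.mul_apply, Pi.sub_apply, Pi.smul_apply, smul_eq_mul]
        ring
      have h4 : algebraMap (SymDual n) (QuotField n) (C (2 ^ Γ.index ξ t)) ≠ 0 := by simp
      rw [h2, integral_smul, hdual] at h1
      rw [h3, integral_sub, integral_smul, integral_smul, hdual]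
      by_cases htp : t = p
      · subst htp
        rw [← h1]; simp
      · rw [if_neg htp, map_zero, mul_zero, eq_comm, mul_eq_zero] at h1
        rw [if_neg htp, h1.resolve_left h4]; simp
    have hq := sub_eq_zero.1 (congrFun key q)
    exact isHomogeneous_of_dilate_eq hq (by rw [add_comm]; exact index_add_index_neg hξ p)
  · by_contra h
    exact hq (hsupp q fun h' => h h'.neg)
  · apply nu_neg_of_mul hξ
    have := integral_eq_of_support hφ (p := p) (fun t => (hτ p).eq_zero) hsupp
    rw [hdual, if_pos rfl, (hτ p).value] at this
    exact this.symm

/-- If the index increases along ascending paths, then Thom classes for `ξ` and `-ξ` are dual to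
each other. -/
theorem integral_mul_thomClass_neg [DecidableEq V] (hξ : Γ.IsPolarizing ξ) {φ : V → ℝ}
    (hφ : Γ.IsMorse ξ φ) (hinc : Γ.IndexIncreasing ξ) {τ η : V → V → SymDual n}
    (hτ : ∀ p, Γ.IsThomClass ξ p (τ p)) (hη : ∀ p, Γ.IsThomClass (-ξ) p (η p)) (p q : V) :
    Γ.integral (τ p * η q) = if p = q then 1 else 0 := by
  have hηq : ∀ t, ¬ Γ.Reaches ξ t q → η q t = 0 := fun t ht =>
    (hη q).eq_zero fun h => ht (reaches_neg_iff.1 h)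
  split_ifs with hpq
  · subst hpq
    rw [integral_eq_of_support hφ (fun t => (hτ p).eq_zero) hηq, (hτ p).value, (hη p).value,
      delta_eq hξ]
    refine mul_inv_cancel₀ ?_
    simpa using ⟨nu_ne_zero hξ p, nu_ne_zero hξ.neg p⟩
  · by_cases hr : Γ.Reaches ξ p q
    · obtain ⟨y, hy⟩ := exists_algebraMap_eq_integral hξ (mul_mem (hτ p).mem (hη q).mem)
      have h1 := dilateQuot_integral hξ (τ p * η q)
      have h2 : (fun u => dilate n ((τ p * η q) u)) =
          (C (2 ^ (Γ.index ξ p + Γ.index (-ξ) q)) : SymDual n) • (τ p * η q) := by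
        funext u
        rw [Pi.smul_apply, smul_eq_mul, Pi.mul_apply]
        exact dilate_eq_of_isHomogeneous (((hτ p).homogeneous u).mul ((hη q).homogeneous u))
      rw [h2, integral_smul, ← hy, dilateQuot_algebraMap, ← map_mul, ← map_mul] at h1
      have h3 := FaithfulSMul.algebraMap_injective (SymDual n) (QuotField n) h1
      have h4 := hinc.index_lt hr hpq
      have h5 := index_add_index_neg hξ q
      -- The integral is a polynomial of degree `σ_p + (d - σ_q) - d < 0`.
      rw [← hy, eq_zero_of_dilate_eq h3 (by omega), map_zero]
    · refine Finset.sum_eq_zero fun t _ => ?_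
      rw [Pi.mul_apply]
      by_cases h1 : Γ.Reaches ξ p t
      · rw [hηq t fun h2 => hr (h1.trans h2), mul_zero, map_zero, zero_mul]
      · rw [(hτ p).eq_zero h1, zero_mul, map_zero, zero_mul]

end Finite

end GKMGraph

/-! ### Values of canonical classes as sums over paths. -/

namespace GKMGraph

open MvPolynomial

variable {n d : ℕ} {V E : Type*} {Γ : GKMGraph n d V E} {ξ : Fin n → ℝ}

/-- The set of ascending paths from `p` to `q`. -/
def ascPaths (Γ : GKMGraph n d V E) (ξ : Fin n → ℝ) (p q : V) : Set (List E) :=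
  {γ | Γ.IsAscPath ξ p γ q}

theorem hatWt_bar (Γ : GKMGraph n d V E) (ξ : Fin n → ℝ) (e : E) :
    Γ.hatWt ξ (Γ.bar e) = Γ.hatWt ξ e := by
  rw [hatWt, hatWt, wt_bar_dotProduct, Γ.wt_bar, linForm_neg, map_neg, map_neg, neg_div_neg_eq]

theorem IsMorse.ascPaths_self {φ : V → ℝ} (hφ : Γ.IsMorse ξ φ) (p : V) :
    Γ.ascPaths ξ p p = {[]} := by
  ext γ
  constructor
  · intro h
    by_contra hne
    exact lt_irrefl _ (hφ.lt_of_isAscPath h hne)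
  · rintro rfl
    exact (rfl : p = p)

section Finite

variable [Fintype E]

theorem ascPaths_eq_biUnion (Γ : GKMGraph n d V E) (ξ : Fin n → ℝ) {p q : V} (hqp : q ≠ p) :
    Γ.ascPaths ξ p q = ⋃ e ∈ (Γ.descEdges ξ q : Set E),
      (fun γ => γ ++ [Γ.bar e]) '' Γ.ascPaths ξ p (Γ.tgt e) := by
  ext γ
  simp only [Set.mem_iUnion, Set.mem_image, exists_prop, Finset.mem_coe, mem_descEdges]
  constructor
  · intro h
    rcases List.eq_nil_or_concat' γ with rfl | ⟨l, e, rfl⟩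
    · exact absurd (Eq.symm h) hqp
    · obtain ⟨h1, h2, h3⟩ := isAscPath_concat.1 h
      refine ⟨Γ.bar e, ⟨by rw [Γ.src_bar, h3], ?_⟩, l, ?_, by rw [Γ.bar_bar]⟩
      · rw [← isAscending_bar, Γ.bar_bar]; exact h2
      · rw [tgt_bar]; exact h1
  · rintro ⟨e, ⟨rfl, he⟩, l, hl, rfl⟩
    exact isAscPath_concat.2 ⟨by rw [Γ.src_bar]; exact hl, isAscending_bar.2 he, Γ.tgt_bar e⟩

theorem IsMorse.induction [Finite V] {φ : V → ℝ} (hφ : Γ.IsMorse ξ φ) {P : V → Prop}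
    (step : ∀ q, (∀ e ∈ Γ.descEdges ξ q, P (Γ.tgt e)) → P q) (q : V) : P q := by
  by_contra h
  obtain ⟨t, ht, hmin⟩ := Set.exists_min_image {t | ¬ P t} φ (Set.toFinite _) ⟨q, h⟩
  refine ht (step t fun e he => ?_)
  by_contra h'
  exact absurd (hφ.lt_of_mem_descEdges he) (not_lt.2 (hmin _ h'))

theorem IsMorse.finite_ascPaths [Finite V] {φ : V → ℝ} (hφ : Γ.IsMorse ξ φ) (p q : V) :
    (Γ.ascPaths ξ p q).Finite := by
  induction q using hφ.induction with
  | step q ih =>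
    by_cases hqp : q = p
    · rw [hqp, hφ.ascPaths_self]
      exact Set.finite_singleton _
    · rw [ascPaths_eq_biUnion Γ ξ hqp]
      exact Set.Finite.biUnion (Finset.finite_toSet _) fun e he => (ih e he).image _

/-- The factor `E(γ) / ν_q⁺` of the weight of a path, with a parameter `y`. -/
noncomputable def chainWeight (Γ : GKMGraph n d V E) (ξ : Fin n → ℝ) :
    List E → QuotField n → QuotField n
  | [], _ => 1
  | [e], y => -(Γ.iota ξ e / (Γ.hatWt ξ e - y))
  | e :: f :: l, y => -(Γ.iota ξ e / (Γ.hatWt ξ e - Γ.hatWt ξ f)) * chainWeight Γ ξ (f :: l) y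

/-- The reason for the parameter: a new last edge `e` evaluates the old chain at `y = α̂_e`, just as
interpolation applies `ρ_e`, the translation with that parameter. -/
theorem chainWeight_concat (Γ : GKMGraph n d V E) (ξ : Fin n → ℝ) (γ : List E) (e : E)
    (y : QuotField n) : Γ.chainWeight ξ (γ ++ [e]) y =
      -(Γ.iota ξ e / (Γ.hatWt ξ e - y)) * Γ.chainWeight ξ γ (Γ.hatWt ξ e) := by
  induction γ with
  | nil => simp [chainWeight]
  | cons f l ih =>
    cases l with
    | nil => simp only [List.cons_append, List.nil_append, chainWeight]; ring
    | cons g l =>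
      simp only [List.cons_append, chainWeight] at ih ⊢
      rw [ih]
      ring

/-- The same numerators and denominators, paired differently: `ι_{e_k}` stands over `α̂_{k-1} -
α̂_k` in `E(γ)`, and over `α̂_k - α̂_{k+1}` in the chain, whose last denominator is `α̂_m - y`. -/
theorem pathWeight_eq (Γ : GKMGraph n d V E) (ξ : Fin n → ℝ) (q : V) (γ : List E) :
    Γ.pathWeight ξ q γ =
      algebraMap (SymDual n) (QuotField n) (Γ.nu ξ q) * Γ.chainWeight ξ γ 0 := by
  induction γ with
  | nil => simp [pathWeight, chainWeight]
  | cons e l ih =>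
    cases l with
    | nil => simp [pathWeight, chainWeight]
    | cons f l =>
      rw [chainWeight, mul_left_comm, ← ih]
      simp only [pathWeight, List.zip_cons_cons, List.map_cons, List.prod_cons, List.length_cons,
        List.getLast_cons_cons]
      ring

/-- One step of the interpolation formula along a descending edge `e`. -/
theorem shift_nu_mul_iota (hξ : Γ.IsPolarizing ξ) {q : V} {e : E} (he : e ∈ Γ.descEdges ξ q)
    {y : QuotField n} (hy : shift ξ y (Γ.nu ξ q) ≠ 0) [DecidableEq E] :
    shift ξ y (Γ.nu ξ q) * -(Γ.iota ξ (Γ.bar e) / (Γ.hatWt ξ (Γ.bar e) - y)) =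
      shift ξ y (∏ f ∈ (Γ.descEdges ξ q).erase e, linForm (Γ.wt f)) *
        shift ξ (Γ.hatWt ξ e) (Γ.nu ξ (Γ.tgt e)) /
          algebraMap (SymDual n) (QuotField n)
            (Γ.rho ξ e (∏ f ∈ (Γ.descEdges ξ q).erase e, linForm (Γ.wt f))) := by
  have hc : algebraMap ℝ (QuotField n) (Γ.wt e ⬝ᵥ ξ) ≠ 0 := by simpa using hξ e
  have hα : shift ξ y (linForm (Γ.wt e)) =
      algebraMap ℝ (QuotField n) (Γ.wt e ⬝ᵥ ξ) * (Γ.hatWt ξ e - y) := by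
    rw [shift_linForm, hatWt, mul_sub, mul_div_cancel₀ _ hc]
  have hν : shift ξ y (Γ.nu ξ q) = algebraMap ℝ (QuotField n) (Γ.wt e ⬝ᵥ ξ) *
      (Γ.hatWt ξ e - y) * shift ξ y (∏ f ∈ (Γ.descEdges ξ q).erase e, linForm (Γ.wt f)) := by
    rw [← hα, ← map_mul, nu, Finset.mul_prod_erase _ (fun f => linForm (Γ.wt f)) he]
  have h0 : Γ.hatWt ξ e - y ≠ 0 := by
    intro h
    rw [hν, h, mul_zero, zero_mul] at hy
    exact hy rfl
  have hι : Γ.iota ξ (Γ.bar e) = shift ξ (Γ.hatWt ξ e) (Γ.nu ξ (Γ.tgt e)) /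
      algebraMap (SymDual n) (QuotField n)
        (Γ.rho ξ e (∏ f ∈ (Γ.descEdges ξ q).erase e, linForm (Γ.wt f))) /
          -algebraMap ℝ (QuotField n) (Γ.wt e ⬝ᵥ ξ) := by
    rw [iota, Γ.src_bar, tgt_bar, Γ.bar_bar, wt_bar_dotProduct, map_neg, ← algebraMap_rho, nu,
      map_prod, map_prod, map_prod, map_prod, (mem_descEdges.1 he).1]
    simp only [rho_linForm, rhoWt_bar]
    congr!
  rw [hatWt_bar, hι, hν, div_neg, neg_div, neg_neg]
  field_simp

/-- The path formula translated by an arbitrary `y`. The generality is needed for the induction,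
where lower vertices enter with `y = α̂_e`; nonvanishing of the translated `ν_q⁺` keeps `y` away
from the poles `α̂_e`, `e ∈ E_q⁻`. -/
theorem IsCanonicalThomClass.shift_eq [Finite V] (hξ : Γ.IsPolarizing ξ) {φ : V → ℝ}
    (hφ : Γ.IsMorse ξ φ) {p : V} {τ : V → SymDual n} (hτ : Γ.IsCanonicalThomClass ξ p τ) (q : V) :
    ∀ y : QuotField n, shift ξ y (Γ.nu ξ q) ≠ 0 → shift ξ y (τ q) =
      shift ξ y (Γ.nu ξ q) * ∑ᶠ γ ∈ Γ.ascPaths ξ p q, Γ.chainWeight ξ γ y := by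
  classical
  induction q using hφ.induction with
  | step q ih =>
    intro y hy
    by_cases hqp : q = p
    · rw [hqp, hφ.ascPaths_self, finsum_mem_singleton, hτ.value, chainWeight, mul_one]
    have hrho : ∀ e ∈ Γ.descEdges ξ q, Γ.rho ξ e (∏ f ∈ (Γ.descEdges ξ q).erase e,
        linForm (Γ.wt f)) ≠ 0 := by
      intro e he
      rw [map_prod, Finset.prod_ne_zero_iff]
      intro f hf
      rw [Finset.mem_erase, mem_descEdges] at hf
      rw [rho_linForm]
      exact linForm_ne_zero (rhoWt_ne_zero ξ ((mem_descEdges.1 he).1.trans hf.2.1.symm) hf.1)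
    -- Translation by `y` may kill polynomials and so need not extend to fractions. The denominators
    -- here lie in the image of `ρ_e`, so it fixes them.
    have h1 := map_eq_sum_div_of_algebraMap_eq (K := QuotField n)
      (shift ξ y : SymDual n →+* QuotField n) (Γ.descEdges ξ q) (τ q)
      (fun e => (∏ f ∈ (Γ.descEdges ξ q).erase e, linForm (Γ.wt f)) * Γ.rho ξ e (τ (Γ.tgt e)))
      (fun e => Γ.rho ξ e (∏ f ∈ (Γ.descEdges ξ q).erase e, linForm (Γ.wt f)))
      (fun e he => by
        rw [AlgHom.coe_toRingHom, shift_rho hξ, Ne, FaithfulSMul.algebraMap_eq_zero_iff]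
        exact hrho e he)
      (by
        rw [hτ.interpolation q hqp]
        refine Finset.sum_congr rfl fun e _ => ?_
        rw [Finset.prod_div_distrib, map_mul, map_prod, map_prod, map_prod, mul_div_right_comm]
        simp only [rho_linForm])
    simp only [AlgHom.coe_toRingHom] at h1
    rw [h1, ascPaths_eq_biUnion Γ ξ hqp, finsum_mem_biUnion _ (Finset.finite_toSet _)
      fun e _ => (hφ.finite_ascPaths p (Γ.tgt e)).image _, finsum_mem_coe_finset, Finset.mul_sum]
    · refine Finset.sum_congr rfl fun e he => ?_
      -- The reversed edge ascends from the lower end, so no descending weight there is proportional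
      -- to `α_e`.
      have hν : shift ξ (Γ.hatWt ξ e) (Γ.nu ξ (Γ.tgt e)) ≠ 0 := by
        rw [← algebraMap_rho, ← rho_bar, Ne, FaithfulSMul.algebraMap_eq_zero_iff]
        refine rho_nu_ne_zero_of_notMem (Γ.src_bar e) fun h => ?_
        have h2 := (mem_descEdges.1 h).2
        have h3 := (mem_descEdges.1 he).2
        rw [wt_bar_dotProduct] at h2
        linarith
      rw [finsum_mem_image fun _ _ _ _ h => List.append_left_injective _ h, map_mul, shift_rho hξ,
        shift_rho hξ, algebraMap_rho _ _ _ (τ _), ih e he _ hν]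
      simp only [chainWeight_concat, hatWt_bar Γ ξ e]
      rw [← mul_finsum_mem, ← mul_assoc (shift ξ y (Γ.nu ξ q)),
        ← hatWt_bar Γ ξ e, shift_nu_mul_iota hξ he hy, hatWt_bar]
      ring
    · intro e _ f _ hef
      rw [Function.onFun, Set.disjoint_left]
      rintro _ ⟨l, _, rfl⟩ ⟨l', _, h⟩
      have := List.append_inj_right' h rfl
      exact hef (Γ.bar_injective (List.singleton_inj.1 this)).symm

/-- The values of the canonical Thom classes as sums over paths. -/
theorem IsCanonicalThomClass.algebraMap_eq [Finite V] (hξ : Γ.IsPolarizing ξ) {φ : V → ℝ}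
    (hφ : Γ.IsMorse ξ φ) {p : V} {τ : V → SymDual n} (hτ : Γ.IsCanonicalThomClass ξ p τ) (q : V) :
    algebraMap (SymDual n) (QuotField n) (τ q) =
      ∑ γ ∈ (hφ.finite_ascPaths p q).toFinset, Γ.pathWeight ξ q γ := by
  have h := hτ.shift_eq hξ hφ q 0 (by
    rw [shift_zero, Ne, FaithfulSMul.algebraMap_eq_zero_iff]; exact nu_ne_zero hξ q)
  rw [shift_zero, shift_zero, finsum_mem_eq_finite_toFinset_sum _ (hφ.finite_ascPaths p q),
    Finset.mul_sum] at h
  rw [h]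
  exact Finset.sum_congr rfl fun γ _ => (Γ.pathWeight_eq ξ q γ).symm

variable [Fintype V]

theorem finite_configurations {φ : V → ℝ} (hφ : Γ.IsMorse ξ φ) (p q r : V) :
    (Γ.configurations ξ p q r).Finite := by
  refine (Set.finite_iUnion fun t => (Set.finite_singleton t).prod ((hφ.finite_ascPaths p t).prod
    ((hφ.finite_ascPaths q t).prod (hφ.neg.finite_ascPaths r t)))).subset ?_
  rintro ⟨t, a, b, c⟩ ⟨h1, h2, h3⟩
  exact Set.mem_iUnion.2 ⟨t, rfl, h1, h2, h3⟩

theorem integral_eq_configurationSum (hξ : Γ.IsPolarizing ξ) {φ : V → ℝ} (hφ : Γ.IsMorse ξ φ)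
    {p q r : V} {τ τ' η : V → SymDual n} (hτ : Γ.IsCanonicalThomClass ξ p τ)
    (hτ' : Γ.IsCanonicalThomClass ξ q τ') (hη : Γ.IsCanonicalThomClass (-ξ) r η) :
    Γ.integral (τ * τ' * η) = Γ.configurationSum ξ p q r := by
  rw [configurationSum, finsum_mem_eq_finite_toFinset_sum _ (finite_configurations hφ p q r),
    Finset.sum_finset_product _ Finset.univ (fun t => (hφ.finite_ascPaths p t).toFinset ×ˢ
      ((hφ.finite_ascPaths q t).toFinset ×ˢ (hφ.neg.finite_ascPaths r t).toFinset))
      (by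
        rintro ⟨t, a, b, c⟩
        simp [configurations, ascPaths])]
  refine Finset.sum_congr rfl fun t _ => ?_
  rw [Pi.mul_apply, Pi.mul_apply, map_mul, map_mul, hτ.algebraMap_eq hξ hφ,
    hτ'.algebraMap_eq hξ hφ, hη.algebraMap_eq hξ.neg hφ.neg, Finset.sum_product, mul_assoc,
    mul_assoc, Finset.sum_mul]
  refine Finset.sum_congr rfl fun a _ => ?_
  rw [Finset.sum_product, Finset.sum_mul, Finset.mul_sum]
  refine Finset.sum_congr rfl fun b _ => ?_
  rw [Finset.sum_mul, Finset.mul_sum, Finset.mul_sum]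
  exact Finset.sum_congr rfl fun c _ => by ring

theorem algebraMap_structureConstant [DecidableEq V] {τ η : V → V → SymDual n}
    (hdual : ∀ p q, Γ.integral (τ p * η q) = if p = q then 1 else 0) {h : V → SymDual n}
    {c : V → SymDual n} (hc : h = ∑ s, c s • τ s) (r : V) :
    algebraMap (SymDual n) (QuotField n) (c r) = Γ.integral (h * η r) := by
  rw [hc, Finset.sum_mul, integral_sum]
  simp only [smul_mul_assoc, integral_smul, hdual, mul_ite, mul_one, mul_zero,
    Finset.sum_ite_eq', Finset.mem_univ, if_true]

/-- With coefficients `∫ h η_s`, the difference of the two sides is orthogonal to every `η_t`;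
triangularity for `-ξ` makes it vanish. -/
theorem exists_structureConstants [DecidableEq V] (hξ : Γ.IsPolarizing ξ) {φ : V → ℝ}
    (hφ : Γ.IsMorse ξ φ) {τ η : V → V → SymDual n} (hη : ∀ p, Γ.IsThomClass (-ξ) p (η p))
    (hdual : ∀ p q, Γ.integral (τ p * η q) = if p = q then 1 else 0) {h : V → SymDual n}
    (hh : h ∈ Γ.cohomology) : ∃ c : V → SymDual n, h = ∑ s, c s • τ s := by
  choose c hc using fun s => exists_algebraMap_eq_integral hξ (mul_mem hh (hη s).mem)
  refine ⟨c, sub_eq_zero.1 (eq_zero_of_forall_integral_eq_zero hξ.neg hφ.neg hη fun t => ?_)⟩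
  rw [mul_comm, sub_mul, integral_sub, ← hc, algebraMap_structureConstant hdual rfl, sub_self]

end Finite

end GKMGraph

/-! ### The theorem. -/

open GKMGraph in
theorem theorem1p8 {n d : ℕ} {V E : Type*} [Fintype V] [DecidableEq V] [Fintype E]
    (Γ : GKMGraph n d V E) (ξ : Fin n → ℝ) (hξ : Γ.IsPolarizing ξ)
    (φ : V → ℝ) (hφ : Γ.IsMorse ξ φ)
    (hT : ∀ p, ∃ τ, Γ.IsThomClass ξ p τ) :
    -- the sums over configurations are finite
    (∀ p q r, (Γ.configurations ξ p q r).Finite) ∧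
    -- the classes `τ_p⁺` and `τ_p⁻` exist and are unique
    (∀ p, ∃! τ, Γ.IsCanonicalThomClass ξ p τ) ∧
    (∀ p, ∃! τ, Γ.IsCanonicalThomClass (-ξ) p τ) ∧
    -- the formula for the triple pairing
    (∀ τp τm : V → V → SymDual n,
      (∀ p, Γ.IsCanonicalThomClass ξ p (τp p)) →
      (∀ p, Γ.IsCanonicalThomClass (-ξ) p (τm p)) →
      ∀ p q r, Γ.integral (τp p * τp q * τm r) = Γ.configurationSum ξ p q r) ∧
    -- the case of an index function that increases along ascending paths
    (Γ.IndexIncreasing ξ →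
      ∀ τp τm : V → V → SymDual n,
        (∀ p, Γ.IsThomClass ξ p (τp p)) →
        (∀ p, Γ.IsThomClass (-ξ) p (τm p)) →
        (∀ p q, Γ.integral (τp p * τm q) = if p = q then 1 else 0) ∧
        ∀ p q,
          (∃! c : V → SymDual n, τp p * τp q = ∑ s, c s • τp s) ∧
          ∀ c : V → SymDual n, τp p * τp q = ∑ s, c s • τp s →
            ∀ r, algebraMap (SymDual n) (QuotField n) (c r) =
                Γ.integral (τp p * τp q * τm r) ∧
              algebraMap (SymDual n) (QuotField n) (c r) = Γ.configurationSum ξ p q r) := by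
  have hT' := exists_isThomClass_neg hξ hφ hT
  refine ⟨finite_configurations hφ, fun p => ?_, fun p => ?_, ?_, ?_⟩
  · obtain ⟨τ, hτ⟩ := exists_isCanonicalThomClass hξ hφ hT p
    exact ⟨τ, hτ, fun τ' hτ' => hτ'.eq hφ hτ⟩
  · obtain ⟨τ, hτ⟩ := exists_isCanonicalThomClass hξ.neg hφ.neg hT' p
    exact ⟨τ, hτ, fun τ' hτ' => hτ'.eq hφ.neg hτ⟩
  · intro τp τm hp hm p q r
    exact integral_eq_configurationSum hξ hφ (hp p) (hp q) (hm r)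
  · intro hinc τp τm hp hm
    have hdual := integral_mul_thomClass_neg hξ hφ hinc hp hm
    refine ⟨hdual, fun p q => ⟨?_, fun c hc r => ?_⟩⟩
    · obtain ⟨c, hc⟩ := exists_structureConstants hξ hφ hm hdual
        (mul_mem (hp p).mem (hp q).mem)
      refine ⟨c, hc, fun c' hc' => funext fun r => ?_⟩
      apply FaithfulSMul.algebraMap_injective (SymDual n) (QuotField n)
      rw [algebraMap_structureConstant hdual hc r, algebraMap_structureConstant hdual hc' r]
    · have h := algebraMap_structureConstant hdual hc r
      refine ⟨h, h.trans ?_⟩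
      exact integral_eq_configurationSum hξ hφ ((hp p).isCanonicalThomClass hξ hinc)
        ((hp q).isCanonicalThomClass hξ hinc) ((hm r).isCanonicalThomClass hξ.neg (hinc.neg hξ))
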